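/- Let $\mathfrak{g}=\mathfrak{sl}(2,\mathbb{C})$ with standard basis $e,f,h$, let $V=(\mathbb{C}^2)^{\otimes 4}$ be the tensor product of four copies of its standard representation (highest weight $\omega_1$), and let $\mathbb{A}(\vec\lambda)=V/\mathfrak{g}V$, $\vec\lambda=(\omega_1,\omega_1,\omega_1,\omega_1)$, be its space of coinvariants. For $j\neq k$ let $\Omega_{jk}$ be the operator on $\mathbb{A}(\vec\lambda)$ induced by $\tfrac12 h\otimes h+e\otimes f+f\otimes e$ acting on the $j$-th and $k$-th tensor factors. Let $C_4=\{(z_1,\dots,z_4)\in\mathbb{C}^4 : z_j\neq z_k \text{ for } j\neq k\}$ be the configuration space of ordered 4-tuples of distinct points of the affine line. For $\kappa\in\mathbb{C}^*$, the Knizhnik–Zamolodchikov (KZ) connection on the trivial bundle over $C_4$ with fiber $\mathbb{A}(\vec\lambda)$ is $$\nabla_{\partial/\partial z_j}=\frac{\partial}{\partial z_j}+\frac1\kappa\sum_{k\neq j}\frac{\Omega_{jk}}{z_j-z_k},\qquad j=1,\dots,4 .$$ **Proposition.** The space $\mathbb{A}(\vec\lambda)$ is $2$-dimensional. Let $\kappa=3$.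 For every base point $z_0\in C_4$, analytic continuation of flat sections of the KZ connection along loops is well defined on homotopy classes and gives a monodromy representation $\pi_1(C_4,z_0)\to \mathrm{GL}(\mathbb{A}(\vec\lambda))$, and this representation is not semisimple. -/

import Mathlib

open scoped TensorProduct Topology

noncomputable section

namespace KZ

/-- The tensor product of `n` copies of the standard representation `ℂ²` of `𝔰𝔩(2)`. -/
abbrev TensorRep (n : ℕ) : Type :=
  ⨂[ℂ] _ : Fin n, (Fin 2 → ℂ)

variable {n : ℕ}

/-- A `2 × 2` matrix acting on the `j`-th tensor factor (and as the identity on the others). -/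
def site (j : Fin n) (x : Matrix (Fin 2) (Fin 2) ℂ) : Module.End ℂ (TensorRep n) :=
  PiTensorProduct.map
    (Function.update (fun _ : Fin n => (LinearMap.id : (Fin 2 → ℂ) →ₗ[ℂ] (Fin 2 → ℂ))) j
      (Matrix.toLin' x))

/-- The action of a `2 × 2` matrix on the tensor product, as a Lie algebra element:
`x ↦ ∑ⱼ 1 ⊗ ⋯ ⊗ x ⊗ ⋯ ⊗ 1`. -/
def lieAct (n : ℕ) (x : Matrix (Fin 2) (Fin 2) ℂ) : Module.End ℂ (TensorRep n) :=
  ∑ j : Fin n, site j x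

/-- The subspace `𝔤 V` of `V = (ℂ²)^{⊗ n}`, spanned by all `x • v` with `x ∈ 𝔤 = 𝔰𝔩(2)`, `v ∈ V`. -/
def lieRange (n : ℕ) : Submodule ℂ (TensorRep n) :=
  ⨆ x : LieAlgebra.SpecialLinear.sl (Fin 2) ℂ,
    LinearMap.range (lieAct n (x : Matrix (Fin 2) (Fin 2) ℂ))

/-- The space of coinvariants `V / 𝔤 V`. -/
abbrev Coinvariants (n : ℕ) : Type :=
  TensorRep n ⧸ lieRange n

/-- The raising, lowering and diagonal elements `e`, `f`, `h` of `𝔰𝔩(2)`. -/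
def e : Matrix (Fin 2) (Fin 2) ℂ := !![0, 1; 0, 0]


def f : Matrix (Fin 2) (Fin 2) ℂ := !![0, 0; 1, 0]


def h : Matrix (Fin 2) (Fin 2) ℂ := !![1, 0; 0, -1]

/-- The (split) Casimir operator `½ h ⊗ h + e ⊗ f + f ⊗ e` acting on the `j`-th and `k`-th tensor
factors. -/
def casimir (j k : Fin n) : Module.End ℂ (TensorRep n) :=
  (1 / 2 : ℂ) • (site j h * site k h) + site j e * site k f + site j f * site k e

theorem site_mul (j : Fin n) (x y : Matrix (Fin 2) (Fin 2) ℂ) :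
    site j x * site j y = site j (x * y) := by
  unfold site
  rw [← PiTensorProduct.map_mul]
  congr 1
  funext i
  rcases eq_or_ne i j with rfl | hij
  · simp [Matrix.toLin'_mul, Module.End.mul_eq_comp]
  · simp [hij, Module.End.mul_eq_comp]

theorem site_comm {j k : Fin n} (hjk : j ≠ k) (x y : Matrix (Fin 2) (Fin 2) ℂ) :
    site j x * site k y = site k y * site j x := by
  unfold site
  rw [← PiTensorProduct.map_mul, ← PiTensorProduct.map_mul]
  congr 1
  funext i
  by_cases hij : i = j
  · subst hij
    simp [hjk, Module.End.mul_eq_comp]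
  · simp [hij, Module.End.mul_eq_comp]

theorem site_add (j : Fin n) (x y : Matrix (Fin 2) (Fin 2) ℂ) :
    site j (x + y) = site j x + site j y := by
  unfold site
  rw [map_add, PiTensorProduct.map_update_add]

theorem site_smul (j : Fin n) (c : ℂ) (x : Matrix (Fin 2) (Fin 2) ℂ) :
    site j (c • x) = c • site j x := by
  unfold site
  rw [map_smul, PiTensorProduct.map_update_smul]

theorem site_commutator (j : Fin n) (y x : Matrix (Fin 2) (Fin 2) ℂ) :
    site j y * lieAct n x = lieAct n x * site j y + site j (y * x - x * y) := by
  have hsub : site j (y * x - x * y) = site j y * site j x - site j x * site j y := by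
    rw [sub_eq_add_neg, ← neg_one_smul ℂ (x * y), site_add, site_smul, site_mul, site_mul,
      neg_one_smul ℂ (site j (x * y))]
    exact (sub_eq_add_neg _ _).symm
  have key : ∀ k : Fin n, site j y * site k x =
      site k x * site j y + if k = j then site j (y * x - x * y) else 0 := by
    intro k
    by_cases hk : k = j
    · subst hk
      rw [if_pos rfl, hsub]
      abel
    · simp [hk, site_comm (Ne.symm hk)]
  simp only [lieAct, Finset.mul_sum, Finset.sum_mul, key, Finset.sum_add_distrib]
  simp

/-- The Casimir operators commute with the action of `𝔰𝔩(2)`. -/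
theorem casimir_comm (j k : Fin n) (x : LieAlgebra.SpecialLinear.sl (Fin 2) ℂ) :
    casimir j k * lieAct n x = lieAct n x * casimir j k := by
  obtain ⟨x, hx⟩ := x
  have hx' : x 1 1 = - x 0 0 := by
    have h1 : x.trace = 0 := hx
    rw [Matrix.trace_fin_two] at h1
    linear_combination h1
  obtain ⟨p, q, r, rfl⟩ : ∃ p q r : ℂ, x = !![p, q; r, -p] :=
    ⟨x 0 0, x 0 1, x 1 0, by rw [← hx']; exact Matrix.eta_fin_two x⟩
  have hh : h * !![p, q; r, -p] - !![p, q; r, -p] * h = (2 * q) • e + (-2 * r) • f := by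
    ext a b; fin_cases a <;> fin_cases b <;> simp [h, e, f] <;> ring
  have he : e * !![p, q; r, -p] - !![p, q; r, -p] * e = r • h + (-2 * p) • e := by
    ext a b; fin_cases a <;> fin_cases b <;> simp [h, e]
    ring
  have hf : f * !![p, q; r, -p] - !![p, q; r, -p] * f = (2 * p) • f + (-q) • h := by
    ext a b; fin_cases a <;> fin_cases b <;> simp [h, f]
    ring
  have two : ∀ a b : Matrix (Fin 2) (Fin 2) ℂ, site j a * site k b * lieAct n !![p, q; r, -p] =
      lieAct n !![p, q; r, -p] * (site j a * site k b) + site j (a * !![p, q; r, -p] - !![p, q; r, -p] * a) * site k b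
        + site j a * site k (b * !![p, q; r, -p] - !![p, q; r, -p] * b) := by
    intro a b
    rw [mul_assoc, site_commutator k b, mul_add, ← mul_assoc, site_commutator j a, add_mul,
      mul_assoc]
  simp only [casimir, add_mul, mul_add, smul_mul_assoc, mul_smul_comm, two, hh, he, hf, site_add,
    site_smul, smul_add, smul_smul]
  module

/-- The operator `Ω_{jk}` on the space of coinvariants. -/
def casimirCoinv (j k : Fin n) : Module.End ℂ (Coinvariants n) :=
  (lieRange n).mapQ (lieRange n) (casimir j k) <| by
    refine iSup_le fun x => ?_
    rintro _ ⟨v, rfl⟩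
    refine Submodule.mem_iSup_of_mem x ⟨casimir j k v, ?_⟩
    exact (LinearMap.congr_fun (casimir_comm j k x) v).symm

/-- The configuration space of `n`-tuples of distinct points of the affine line `ℂ`. -/
abbrev Conf (n : ℕ) : Type :=
  {z : Fin n → ℂ // Function.Injective z}

/-- The `dzⱼ`-component `(1/κ) ∑_{k ≠ j} Ω_{jk} / (zⱼ - z_k)` of the KZ connection matrix, so that
`∇_{∂/∂zⱼ} = ∂/∂zⱼ + kzMatrix κ z j` on the trivial bundle of coinvariants. -/
def kzMatrix (κ : ℂ) (z : Fin n → ℂ) (j : Fin n) : Module.End ℂ (Coinvariants n) :=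
  κ⁻¹ • ∑ k ∈ Finset.univ.erase j, (z j - z k)⁻¹ • casimirCoinv j k

/-- `u` is a holomorphic flat section of the KZ connection over the set `U` (an open set of
configurations in all uses): `u` is complex differentiable at the points of `U`, with
`∂u/∂zⱼ = - kzMatrix κ z j (u z)`. As the space of coinvariants is a finite-dimensional vector space
with no preferred norm, derivatives are taken after applying an arbitrary linear functional. -/
def IsFlatSection (κ : ℂ) (U : Set (Fin n → ℂ)) (u : (Fin n → ℂ) → Coinvariants n) : Prop :=
  ∀ z ∈ U, ∀ φ : Module.Dual ℂ (Coinvariants n),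
    HasFDerivAt (fun w => φ (u w))
      (∑ j : Fin n, (-φ (kzMatrix κ z j (u z))) •
        (ContinuousLinearMap.proj j : (Fin n → ℂ) →L[ℂ] ℂ)) z

/-- `s` is a continuation of flat sections along the path `γ`: near each time it is
the restriction to `γ` of a local flat section. -/
def IsFlatAlong (κ : ℂ) {a b : Conf n} (γ : Path a b) (s : unitInterval → Coinvariants n) : Prop :=
  ∀ t : unitInterval, ∃ U : Set (Fin n → ℂ), IsOpen U ∧ (γ t : Fin n → ℂ) ∈ U ∧
    (∀ z ∈ U, Function.Injective z) ∧ ∃ u : (Fin n → ℂ) → Coinvariants n,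
      IsFlatSection κ U u ∧ ∀ᶠ t' in 𝓝 t, s t' = u (γ t')

/-- `ρ` is the monodromy representation of the KZ connection with parameter `κ` at the base point
`z₀`: the class of a loop `γ` acts by analytic continuation of flat sections along `γ`. (The product
`p * q` in `FundamentalGroup` is `q` followed by `p`, so parallel transport is multiplicative.) -/
def IsMonodromy (κ : ℂ) (z₀ : Conf n)
    (ρ : Representation ℂ (FundamentalGroup (Conf n) z₀) (Coinvariants n)) : Prop :=
  ∀ (γ : Path z₀ z₀) (a b : Coinvariants n),
    ρ (FundamentalGroup.fromPath (Path.Homotopic.Quotient.mk γ)) a = b ↔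
      ∃ s : unitInterval → Coinvariants n, IsFlatAlong κ γ s ∧ s 0 = a ∧ s 1 = b

end KZ

end

/-!
# Monodromy of the Knizhnik–Zamolodchikov connection on four points at `κ = 3`

The coinvariants of `(ℂ²)^{⊗ 4}` are spanned by the classes `a`, `b`, `c` of the weight zero basis
tensors, with `a + b + c = 0`. The operator `Ω_{jk} + 1 / 2` is the transposition of two tensor
factors, so it permutes `a`, `b`, `c` and only depends on the splitting of the four points into two
pairs. With `X = (z₁ - z₂)(z₃ - z₄)`, `Y = (z₁ - z₃)(z₂ - z₄)`, `T = (z₁ - z₄)(z₂ - z₃)`, which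
satisfy `X = Y - T`, the KZ system is therefore a system in the logarithmic differentials of
`X`, `Y`, `T` (`isFlatSection_iff`).

At `κ = 3` the system is reducible: `(XYT)^{-1/6} (Y, X)` is a solution. All other solutions have
the form `(XYT)^{-1/6} (F Y + β, F X)`, where `β` is a multiple of `(XYT)^{2/3} / X` and `F` is an
incomplete beta integral in the cross ratio `Y / T` (`Cross.flatPair`). This gives bases of
solutions on small balls (`nonempty_frame`). As the trace of the connection is scalar, determinants
of pairs of solutions are proportional to each other, and by Cramer's rule the coefficients of a
solution in such a basis are constant (`cramer_const`). Hence the germs of solutions form a covering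
space of the configuration space (`flatCore`, `isCoveringMap_flatCore`); a flat section along a path
is the same as a lift of the path (`isFlatAlong_iff_continuous`), and the monodromy of this covering
space is the required representation (`monodromyRep`).

The line spanned by `(Y, X)` is preserved by parallel transport. Suppose that it had an invariant
complement. Transport along a path moves the complement to the base point `(0, 3, -1, 1)`, where it
consists of eigenvectors of the two loops in which the first point turns once around `-1` or around
`1`. Off the invariant line, each loop has only one eigenline, given by the integral `F` which
starts at the point encircled: `F` and `β` are then both multiplied by `e^{4πi/3}`, whereas the
solution `F = 1`, `β = 0` is not (`eigenvector_loop`). So the two integrals would have the same ratio `F / β`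
at the base point. But their integrands are positive on the two real segments, so that these ratios
have opposite signs (`not_isSemisimple_monodromyRep`).
-/

noncomputable section

namespace KZ

variable {n : ℕ}

/-! ### Coordinates on the space of coinvariants -/

/-- The basis tensor `e_{p 0} ⊗ ⋯ ⊗ e_{p (n-1)}` of `(ℂ²)^{⊗ n}`. -/
def basisTensor (p : Fin n → Fin 2) : TensorRep n :=
  PiTensorProduct.tprod ℂ fun i => Pi.single (p i) (1 : ℂ)

theorem site_tprod (j : Fin n) (x : Matrix (Fin 2) (Fin 2) ℂ) (v : Fin n → Fin 2 → ℂ) :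
    site j x (PiTensorProduct.tprod ℂ v) =
      PiTensorProduct.tprod ℂ (Function.update v j (x.mulVec (v j))) := by
  rw [site, PiTensorProduct.map_tprod]
  congr 1
  funext i
  rcases eq_or_ne i j with rfl | hij
  · simp
  · simp [hij]

theorem site_basisTensor (j : Fin n) (x : Matrix (Fin 2) (Fin 2) ℂ) (p : Fin n → Fin 2) :
    site j x (basisTensor p) = x 0 (p j) • basisTensor (Function.update p j 0) +
      x 1 (p j) • basisTensor (Function.update p j 1) := by
  have key : ∀ q : Fin 2, basisTensor (Function.update p j q) =
      PiTensorProduct.tprod ℂ (Function.update (fun i => Pi.single (p i) (1 : ℂ)) j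
        (Pi.single q 1 : Fin 2 → ℂ)) := by
    intro q
    rw [basisTensor]
    congr 1
    funext i
    rcases eq_or_ne i j with rfl | hij
    · simp
    · simp [hij]
  have hx : x.mulVec (Pi.single (p j) (1 : ℂ)) =
      x 0 (p j) • (Pi.single 0 1 : Fin 2 → ℂ) + x 1 (p j) • (Pi.single 1 1 : Fin 2 → ℂ) := by
    ext i
    fin_cases i <;> simp [Matrix.mulVec_single]
  rw [key, key, basisTensor, site_tprod, hx, MultilinearMap.map_update_add,
    MultilinearMap.map_update_smul, MultilinearMap.map_update_smul]

theorem add_halves_smul {V : Type*} [AddCommGroup V] [Module ℂ V] (v : V) :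
    (2⁻¹ : ℂ) • v + (2⁻¹ : ℂ) • v = v := by
  module

/-- On two distinct factors the Casimir operator is the transposition of the factors minus
`1 / 2`. -/
theorem casimir_basisTensor {j k : Fin n} (hjk : j ≠ k) (p : Fin n → Fin 2) :
    casimir j k (basisTensor p) =
      basisTensor (p ∘ Equiv.swap j k) - (1 / 2 : ℂ) • basisTensor p := by
  have hsw : p ∘ Equiv.swap j k = Function.update (Function.update p k (p j)) j (p k) := by
    funext i
    rcases eq_or_ne i j with rfl | hij
    · simp
    · rcases eq_or_ne i k with rfl | hik
      · simp [hij]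
      · simp [hij, hik, Equiv.swap_apply_of_ne_of_ne]
  have hp : Function.update (Function.update p k (p k)) j (p j) = p := by simp
  -- stated for `TensorRep n`, as the simp lemmas on scalar actions do not find its group structure
  have hneg : ∀ v : TensorRep n, (-1 : ℂ) • v = -v := fun v => neg_one_smul ℂ v
  have hhalf : ∀ v : TensorRep n, (2⁻¹ : ℂ) • v = v - (2⁻¹ : ℂ) • v := fun v =>
    eq_sub_of_add_eq (add_halves_smul v)
  rw [hsw]
  simp only [casimir, LinearMap.add_apply, LinearMap.smul_apply, Module.End.mul_apply,
    site_basisTensor, map_add, map_smul, Function.update_of_ne hjk]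
  have two : ∀ a : Fin 2, a = 0 ∨ a = 1 := by decide
  rcases two (p j) with h1 | h1 <;> rcases two (p k) with h2 | h2 <;> rw [h1, h2] at hp ⊢ <;>
    simp [h, e, f, hneg, hp]
  · exact hhalf _
  · exact neg_add_eq_sub _ _
  · exact neg_add_eq_sub _ _
  · exact hhalf _

theorem lieAct_add (x y : Matrix (Fin 2) (Fin 2) ℂ) :
    lieAct n (x + y) = lieAct n x + lieAct n y := by
  simp [lieAct, site_add, Finset.sum_add_distrib]

theorem lieAct_smul (c : ℂ) (x : Matrix (Fin 2) (Fin 2) ℂ) :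
    lieAct n (c • x) = c • lieAct n x := by
  simp [lieAct, site_smul, Finset.smul_sum]

theorem lieAct_basisTensor (x : Matrix (Fin 2) (Fin 2) ℂ) (p : Fin n → Fin 2) :
    lieAct n x (basisTensor p) = ∑ j, (x 0 (p j) • basisTensor (Function.update p j 0) +
      x 1 (p j) • basisTensor (Function.update p j 1)) := by
  simp [lieAct, site_basisTensor]

theorem mk_lieAct_eq_zero {x : Matrix (Fin 2) (Fin 2) ℂ} (hx : x.trace = 0) (v : TensorRep n) :
    (lieRange n).mkQ (lieAct n x v) = 0 := by
  rw [Submodule.mkQ_apply, Submodule.Quotient.mk_eq_zero]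
  exact Submodule.mem_iSup_of_mem (⟨x, hx⟩ : LieAlgebra.SpecialLinear.sl (Fin 2) ℂ) ⟨v, rfl⟩

/-- The basis of `(ℂ²)^{⊗ n}` consisting of the basis tensors. -/
def tensorBasis (n : ℕ) : Module.Basis (Fin n → Fin 2) ℂ (TensorRep n) :=
  Basis.piTensorProduct fun _ => Pi.basisFun ℂ (Fin 2)

theorem tensorBasis_apply (p : Fin n → Fin 2) : tensorBasis n p = basisTensor p := by
  rw [tensorBasis, Basis.piTensorProduct_apply]
  simp [basisTensor]

/-- The coordinates of the class of a basis tensor of `(ℂ²)^{⊗ 4}` in the basis `a, b` of the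
coinvariants, where `a`, `b`, `c` are the classes of the basis tensors of weight zero whose first
factor agrees with the second, third, fourth factor respectively, and `a + b + c = 0`. -/
def weightCoord (p : Fin 4 → Fin 2) : ℤ × ℤ :=
  if ∑ j, (p j : ℕ) ≠ 2 then (0, 0) else
    if p 0 = p 1 then (1, 0) else if p 0 = p 2 then (0, 1) else (-1, -1)

/-- The linear extension of `weightCoord` to `(ℂ²)^{⊗ 4}`, as a complex valued map. -/
def tensorCoord : TensorRep 4 →ₗ[ℂ] ℂ × ℂ :=
  (tensorBasis 4).constr ℂ fun p => (((weightCoord p).1 : ℂ), ((weightCoord p).2 : ℂ))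

theorem tensorCoord_basisTensor (p : Fin 4 → Fin 2) :
    tensorCoord (basisTensor p) = (((weightCoord p).1 : ℂ), ((weightCoord p).2 : ℂ)) := by
  rw [← tensorBasis_apply, tensorCoord, Module.Basis.constr_basis]

theorem sum_weightCoord_raise : ∀ p : Fin 4 → Fin 2,
    ∑ j, (if p j = 1 then weightCoord (Function.update p j 0) else 0) = 0 := by decide

theorem sum_weightCoord_lower : ∀ p : Fin 4 → Fin 2,
    ∑ j, (if p j = 0 then weightCoord (Function.update p j 1) else 0) = 0 := by decide

theorem sum_weightCoord_diag : ∀ p : Fin 4 → Fin 2,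
    ∑ j, (if p j = 0 then weightCoord p else -weightCoord p) = 0 := by decide

theorem tensorCoord_lieAct (x : LieAlgebra.SpecialLinear.sl (Fin 2) ℂ) :
    tensorCoord ∘ₗ lieAct 4 (x : Matrix (Fin 2) (Fin 2) ℂ) = 0 := by
  obtain ⟨x, hx⟩ := x
  have h1 : x.trace = 0 := hx
  rw [Matrix.trace_fin_two] at h1
  have hx' : x = x 0 0 • h + (x 0 1 • e + x 1 0 • f) := by
    have h2 : x 1 1 = - x 0 0 := by linear_combination (norm := module) h1
    ext a b; fin_cases a <;> fin_cases b <;> simp [h, e, f, h2]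
  have two : ∀ a : Fin 2, a = 0 ∨ a = 1 := by decide
  -- each of the three relations is an identity between integer vectors
  let ι : ℤ × ℤ →+ ℂ × ℂ := (Int.castAddHom ℂ).prodMap (Int.castAddHom ℂ)
  have hι : ∀ p, tensorCoord (basisTensor p) = ι (weightCoord p) := fun p => by
    rw [tensorCoord_basisTensor]; rfl
  have he : tensorCoord ∘ₗ lieAct 4 e = 0 := by
    refine (tensorBasis 4).ext fun p => ?_
    have := congrArg ι (sum_weightCoord_raise p)
    rw [map_sum, map_zero] at this
    rw [LinearMap.comp_apply, tensorBasis_apply, lieAct_basisTensor, map_sum,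
      LinearMap.zero_apply, ← this]
    refine Finset.sum_congr rfl fun j _ => ?_
    rcases two (p j) with h | h <;> simp [h, e, hι]
  have hf : tensorCoord ∘ₗ lieAct 4 f = 0 := by
    refine (tensorBasis 4).ext fun p => ?_
    have := congrArg ι (sum_weightCoord_lower p)
    rw [map_sum, map_zero] at this
    rw [LinearMap.comp_apply, tensorBasis_apply, lieAct_basisTensor, map_sum,
      LinearMap.zero_apply, ← this]
    refine Finset.sum_congr rfl fun j _ => ?_
    rcases two (p j) with h | h <;> simp [h, f, hι]
  have hh : tensorCoord ∘ₗ lieAct 4 h = 0 := by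
    refine (tensorBasis 4).ext fun p => ?_
    have := congrArg ι (sum_weightCoord_diag p)
    rw [map_sum, map_zero] at this
    rw [LinearMap.comp_apply, tensorBasis_apply, lieAct_basisTensor, map_sum,
      LinearMap.zero_apply, ← this]
    refine Finset.sum_congr rfl fun j _ => ?_
    have hp : p = Function.update p j (p j) := by simp
    rcases two (p j) with h' | h' <;> rw [h'] at hp <;> simp [h', h, hι, ← hp]
  change tensorCoord ∘ₗ lieAct 4 x = 0
  rw [hx', lieAct_add, lieAct_add, lieAct_smul, lieAct_smul, lieAct_smul, LinearMap.comp_add,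
    LinearMap.comp_add, LinearMap.comp_smul, LinearMap.comp_smul, LinearMap.comp_smul, he, hf, hh]
  simp

/-- The element `h` acts on a basis tensor by its weight, so basis tensors of non-zero weight lie in
`𝔤 V`. -/
theorem mk_basisTensor_of_weight_ne (p : Fin n → Fin 2)
    (hp : ∑ j, (if p j = 0 then 1 else -1 : ℤ) ≠ 0) :
    (lieRange n).mkQ (basisTensor p) = 0 := by
  have two : ∀ a : Fin 2, a = 0 ∨ a = 1 := by decide
  have h1 : lieAct n h (basisTensor p) =
      ((∑ j, (if p j = 0 then 1 else -1 : ℤ) : ℤ) : ℂ) • basisTensor p := by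
    rw [lieAct_basisTensor, Int.cast_sum, Finset.sum_smul]
    refine Finset.sum_congr rfl fun j _ => ?_
    have hp : p = Function.update p j (p j) := by simp
    have hneg : (-1 : ℂ) • basisTensor p = -basisTensor p := neg_one_smul ℂ (basisTensor p)
    rcases two (p j) with h' | h' <;> rw [h'] at hp <;> simp [h', h, ← hp, hneg]
  have h2 := mk_lieAct_eq_zero (n := n) (x := h) (by simp [h]) (basisTensor p)
  rw [h1, map_smul, smul_eq_zero] at h2
  exact h2.resolve_left (by exact_mod_cast hp)

/-- Every basis tensor of weight zero is a combination of two of them modulo `𝔤 V`: the relations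
are the images under `e` of the basis tensors of weight `-2`. -/
theorem mk_basisTensor (p : Fin 4 → Fin 2) :
    (lieRange 4).mkQ (basisTensor p) =
      ((weightCoord p).1 : ℂ) • (lieRange 4).mkQ (basisTensor ![0, 0, 1, 1]) +
        ((weightCoord p).2 : ℂ) • (lieRange 4).mkQ (basisTensor ![0, 1, 0, 1]) := by
  have he : ∀ p : Fin 4 → Fin 2, ∑ j, (if p j = 1 then
      (lieRange 4).mkQ (basisTensor (Function.update p j 0)) else 0) = 0 := by
    intro p
    refine Eq.trans ?_ (mk_lieAct_eq_zero (n := 4) (x := e) (by simp [e]) (basisTensor p))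
    rw [lieAct_basisTensor, map_sum]
    refine Finset.sum_congr rfl fun j _ => ?_
    have two : ∀ a : Fin 2, a = 0 ∨ a = 1 := by decide
    rcases two (p j) with h | h <;> simp [h, e]
  have u : ∀ a b c d : Fin 2, Function.update ![a, b, c, d] 0 0 = ![0, b, c, d] ∧
      Function.update ![a, b, c, d] 1 0 = ![a, 0, c, d] ∧
      Function.update ![a, b, c, d] 2 0 = ![a, b, 0, d] ∧
      Function.update ![a, b, c, d] 3 0 = ![a, b, c, 0] := by decide
  have h1 := he ![0, 1, 1, 1]
  have h2 := he ![1, 0, 1, 1]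
  have h3 := he ![1, 1, 0, 1]
  have h4 := he ![1, 1, 1, 0]
  simp [Fin.sum_univ_four, u] at h1 h2 h3 h4
  -- the remaining classes vanish, or are determined by these four relations
  by_cases hp : ∑ j, (if p j = 0 then 1 else -1 : ℤ) ≠ 0
  · have h0 : ∀ p : Fin 4 → Fin 2, ∑ j, (if p j = 0 then 1 else -1 : ℤ) ≠ 0 →
        weightCoord p = (0, 0) := by decide
    rw [mk_basisTensor_of_weight_ne p hp, h0 p hp]
    simp
  · have h0 : ∀ p : Fin 4 → Fin 2, ¬ ∑ j, (if p j = 0 then 1 else -1 : ℤ) ≠ 0 →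
        (p = ![0, 0, 1, 1] ∧ weightCoord p = (1, 0)) ∨
        (p = ![1, 1, 0, 0] ∧ weightCoord p = (1, 0)) ∨
        (p = ![0, 1, 0, 1] ∧ weightCoord p = (0, 1)) ∨
        (p = ![1, 0, 1, 0] ∧ weightCoord p = (0, 1)) ∨
        (p = ![0, 1, 1, 0] ∧ weightCoord p = (-1, -1)) ∨
        (p = ![1, 0, 0, 1] ∧ weightCoord p = (-1, -1)) := by decide
    rcases h0 p hp with ⟨rfl, h⟩ | ⟨rfl, h⟩ | ⟨rfl, h⟩ | ⟨rfl, h⟩ | ⟨rfl, h⟩ | ⟨rfl, h⟩ <;>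
      rw [h] <;> simp
    · linear_combination (norm := module) (-1 / 2 : ℂ) • h1 - (1 / 2 : ℂ) • h2 + (1 / 2 : ℂ) • h3 +
        (1 / 2 : ℂ) • h4
    · linear_combination (norm := module) (-1 / 2 : ℂ) • h1 + (1 / 2 : ℂ) • h2 - (1 / 2 : ℂ) • h3 +
        (1 / 2 : ℂ) • h4
    · linear_combination (norm := module) h1
    · linear_combination (norm := module) (1 / 2 : ℂ) • h1 + (1 / 2 : ℂ) • h2 + (1 / 2 : ℂ) • h3 -
        (1 / 2 : ℂ) • h4

/-- The map induced on coinvariants by `tensorCoord`. -/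
def coinvCoord : Coinvariants 4 →ₗ[ℂ] ℂ × ℂ :=
  (lieRange 4).liftQ tensorCoord <| by
    refine iSup_le fun x => ?_
    rintro _ ⟨v, rfl⟩
    exact LinearMap.congr_fun (tensorCoord_lieAct x) v

theorem coinvCoord_mkQ (v : TensorRep 4) : coinvCoord ((lieRange 4).mkQ v) = tensorCoord v := rfl

/-- The space of coinvariants of `(ℂ²)^{⊗ 4}` is identified with `ℂ²`. -/
def coord : Coinvariants 4 ≃ₗ[ℂ] ℂ × ℂ :=
  LinearEquiv.ofLinearMap coinvCoord
    ((LinearMap.toSpanSingleton ℂ _ ((lieRange 4).mkQ (basisTensor ![0, 0, 1, 1]))).coprod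
      (LinearMap.toSpanSingleton ℂ _ ((lieRange 4).mkQ (basisTensor ![0, 1, 0, 1]))))
    (by
      have h1 : weightCoord ![0, 0, 1, 1] = (1, 0) := by decide
      have h2 : weightCoord ![0, 1, 0, 1] = (0, 1) := by decide
      ext <;> simp [-Submodule.mkQ_apply, coinvCoord_mkQ, tensorCoord_basisTensor, h1, h2])
    (by
      refine Submodule.linearMap_qext _ ((tensorBasis 4).ext fun p => ?_)
      simp only [LinearMap.comp_apply, tensorBasis_apply, LinearMap.id_apply]
      rw [mk_basisTensor p, map_add, map_smul, map_smul, map_add, map_smul, map_smul]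
      have h1 : weightCoord ![0, 0, 1, 1] = (1, 0) := by decide
      have h2 : weightCoord ![0, 1, 0, 1] = (0, 1) := by decide
      simp [-Submodule.mkQ_apply, coinvCoord_mkQ, tensorCoord_basisTensor, h1, h2])

theorem finrank_coinvariants : Module.finrank ℂ (Coinvariants 4) = 2 := by
  rw [coord.finrank_eq]; simp

theorem coord_casimirCoinv_aux {j k : Fin 4} (hjk : j ≠ k) (M : ℂ × ℂ →ₗ[ℂ] ℂ × ℂ)
    (hM : ∀ p, tensorCoord (basisTensor (p ∘ Equiv.swap j k)) = M (tensorCoord (basisTensor p)))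
    (u : Coinvariants 4) :
    coord (casimirCoinv j k u) = M (coord u) - (1 / 2 : ℂ) • coord u := by
  have : coord.toLinearMap ∘ₗ casimirCoinv j k =
      M ∘ₗ coord.toLinearMap - (1 / 2 : ℂ) • coord.toLinearMap := by
    refine Submodule.linearMap_qext _ ((tensorBasis 4).ext fun p => ?_)
    rw [tensorBasis_apply]
    change tensorCoord (casimir j k (basisTensor p)) =
      M (tensorCoord (basisTensor p)) - (1 / 2 : ℂ) • tensorCoord (basisTensor p)
    rw [casimir_basisTensor hjk, map_sub, map_smul, hM]
  exact LinearMap.congr_fun this u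

/-- `Ω₁₂ = Ω₃₄` in coordinates. -/
theorem coord_casimirCoinv_fst {j k : Fin 4}
    (hjk : (j, k) ∈ ({(0, 1), (1, 0), (2, 3), (3, 2)} : Finset (Fin 4 × Fin 4)))
    (u : Coinvariants 4) : coord (casimirCoinv j k u) =
      ((coord u).1 / 2 - (coord u).2, -3 / 2 * (coord u).2) := by
  have h1 : ∀ j k : Fin 4,
      (j, k) ∈ ({(0, 1), (1, 0), (2, 3), (3, 2)} : Finset (Fin 4 × Fin 4)) → j ≠ k ∧ ∀ p,
      weightCoord (p ∘ Equiv.swap j k) =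
        ((weightCoord p).1 - (weightCoord p).2, -(weightCoord p).2) := by decide
  rw [coord_casimirCoinv_aux (h1 j k hjk).1
    ((LinearMap.fst ℂ ℂ ℂ - LinearMap.snd ℂ ℂ ℂ).prod (-LinearMap.snd ℂ ℂ ℂ))]
  · ext <;> simp <;> ring
  · intro p
    simp [tensorCoord_basisTensor, (h1 j k hjk).2 p]

/-- `Ω₁₃ = Ω₂₄` in coordinates. -/
theorem coord_casimirCoinv_snd {j k : Fin 4}
    (hjk : (j, k) ∈ ({(0, 2), (2, 0), (1, 3), (3, 1)} : Finset (Fin 4 × Fin 4)))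
    (u : Coinvariants 4) : coord (casimirCoinv j k u) =
      (-3 / 2 * (coord u).1, (coord u).2 / 2 - (coord u).1) := by
  have h1 : ∀ j k : Fin 4,
      (j, k) ∈ ({(0, 2), (2, 0), (1, 3), (3, 1)} : Finset (Fin 4 × Fin 4)) → j ≠ k ∧ ∀ p,
      weightCoord (p ∘ Equiv.swap j k) =
        (-(weightCoord p).1, (weightCoord p).2 - (weightCoord p).1) := by decide
  rw [coord_casimirCoinv_aux (h1 j k hjk).1
    ((-LinearMap.fst ℂ ℂ ℂ).prod (LinearMap.snd ℂ ℂ ℂ - LinearMap.fst ℂ ℂ ℂ))]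
  · ext <;> simp <;> ring
  · intro p
    simp [tensorCoord_basisTensor, (h1 j k hjk).2 p]

/-- `Ω₁₄ = Ω₂₃` in coordinates. -/
theorem coord_casimirCoinv_thd {j k : Fin 4}
    (hjk : (j, k) ∈ ({(0, 3), (3, 0), (1, 2), (2, 1)} : Finset (Fin 4 × Fin 4)))
    (u : Coinvariants 4) : coord (casimirCoinv j k u) =
      ((coord u).2 - (coord u).1 / 2, (coord u).1 - (coord u).2 / 2) := by
  have h1 : ∀ j k : Fin 4,
      (j, k) ∈ ({(0, 3), (3, 0), (1, 2), (2, 1)} : Finset (Fin 4 × Fin 4)) → j ≠ k ∧ ∀ p,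
      weightCoord (p ∘ Equiv.swap j k) = ((weightCoord p).2, (weightCoord p).1) := by decide
  rw [coord_casimirCoinv_aux (h1 j k hjk).1
    ((LinearMap.snd ℂ ℂ ℂ).prod (LinearMap.fst ℂ ℂ ℂ))]
  · ext <;> simp <;> ring
  · intro p
    simp [tensorCoord_basisTensor, (h1 j k hjk).2 p]

/-! ### Flat sections in coordinates -/

section FlatPair

variable {𝕜 : Type*} [NontriviallyNormedField 𝕜] [NormedAlgebra 𝕜 ℂ]
  {E : Type*} [NormedAddCommGroup E] [NormedSpace 𝕜 E]

/-- Three functions `X = Y - T` without zeros near a point, together with their derivatives at that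
point. On the configuration space they are the three products of complementary differences of the
four points; along a curve they are the restrictions of these products. -/
structure Cross (𝕜 : Type*) [NontriviallyNormedField 𝕜] [NormedAlgebra 𝕜 ℂ]
    {E : Type*} [NormedAddCommGroup E] [NormedSpace 𝕜 E] (X Y T : E → ℂ)
    (X' Y' T' : E →L[𝕜] ℂ) (a : E) : Prop where
  hX : HasFDerivAt X X' a
  hY : HasFDerivAt Y Y' a
  hT : HasFDerivAt T T' a
  eq : X a = Y a - T a
  eq' : X' = Y' - T'
  X_ne : X a ≠ 0
  Y_ne : Y a ≠ 0
  T_ne : T a ≠ 0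

/-- The KZ system with `κ = 3` for the pair `(p, q)` of coordinates of a section, at a point. -/
structure FlatPair (𝕜 : Type*) [NontriviallyNormedField 𝕜] [NormedAlgebra 𝕜 ℂ]
    {E : Type*} [NormedAddCommGroup E] [NormedSpace 𝕜 E] (X Y T : E → ℂ)
    (X' Y' T' : E →L[𝕜] ℂ) (p q : E → ℂ) (a : E) : Prop where
  fst : HasFDerivAt p ((-(1 / 3) : ℂ) • (((p a / 2 - q a) / X a) • X' +
    (-3 / 2 * p a / Y a) • Y' + ((q a - p a / 2) / T a) • T')) a
  snd : HasFDerivAt q ((-(1 / 3) : ℂ) • ((-3 / 2 * q a / X a) • X' +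
    ((q a / 2 - p a) / Y a) • Y' + ((p a - q a / 2) / T a) • T')) a

variable {X Y T : E → ℂ} {X' Y' T' : E →L[𝕜] ℂ} {a : E}

/-- Solutions of the KZ system: `g` is a branch of `(XYT)^{-1/6}`, and `β` is a multiple of a
branch of `(XYT)^{2/3} / X`. The choice `F = 1`, `β = 0` gives the invariant line spanned by
`(Y, X)`. -/
theorem Cross.flatPair (hc : Cross 𝕜 X Y T X' Y' T' a) {g F β : E → ℂ}
    (hg : HasFDerivAt g ((-(1 / 6) * g a : ℂ) •
      ((X a)⁻¹ • X' + (Y a)⁻¹ • Y' + (T a)⁻¹ • T')) a)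
    (hF : HasFDerivAt F ((β a / (3 * X a)) • ((Y a)⁻¹ • Y' - (T a)⁻¹ • T')) a)
    (hβ : HasFDerivAt β (β a • ((2 / 3 : ℂ) • ((Y a)⁻¹ • Y' + (T a)⁻¹ • T') -
      (1 / 3 * (X a)⁻¹) • X')) a) :
    FlatPair 𝕜 X Y T X' Y' T' (fun e => g e * (F e * Y e + β e))
      (fun e => g e * (F e * X e)) a := by
  obtain ⟨hX, hY, hT, eq, eq', X0, Y0, T0⟩ := hc
  constructor
  · refine (hg.mul ((hF.mul hY).add hβ)).congr_fderiv ?_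
    ext v
    have e2 : X' v = Y' v - T' v := by rw [eq']; rfl
    simp
    have e3 : T a = Y a - X a := by rw [eq]; ring
    rw [e2]
    generalize Y' v = y
    generalize T' v = t
    field_simp
    rw [e3]
    ring
  · refine (hg.mul (hF.mul hX)).congr_fderiv ?_
    ext v
    have e2 : X' v = Y' v - T' v := by rw [eq']; rfl
    simp
    have e3 : T a = Y a - X a := by rw [eq]; ring
    rw [e2]
    generalize Y' v = y
    generalize T' v = t
    field_simp
    rw [e3]
    ring

theorem FlatPair.smul {p q : E → ℂ} (hp : FlatPair 𝕜 X Y T X' Y' T' p q a) (c : ℂ) :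
    FlatPair 𝕜 X Y T X' Y' T' (fun e => c * p e) (fun e => c * q e) a := by
  constructor
  · refine (hp.fst.const_mul c).congr_fderiv ?_
    ext v; simp; ring
  · refine (hp.snd.const_mul c).congr_fderiv ?_
    ext v; simp; ring

theorem FlatPair.add {p q p₂ q₂ : E → ℂ} (hp : FlatPair 𝕜 X Y T X' Y' T' p q a)
    (hp₂ : FlatPair 𝕜 X Y T X' Y' T' p₂ q₂ a) :
    FlatPair 𝕜 X Y T X' Y' T' (fun e => p e + p₂ e) (fun e => q e + q₂ e) a := by
  constructor
  · refine (hp.fst.add hp₂.fst).congr_fderiv ?_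
    ext v; simp; ring
  · refine (hp.snd.add hp₂.snd).congr_fderiv ?_
    ext v; simp; ring

/-- The determinant of two pairs of functions. -/
def wronskian (u v : E → ℂ × ℂ) (e : E) : ℂ :=
  (u e).1 * (v e).2 - (u e).2 * (v e).1

/-- The determinant of two solutions satisfies a scalar equation which does not depend on them:
the trace of the connection is scalar. -/
theorem FlatPair.wronskian {u v : E → ℂ × ℂ}
    (hu : FlatPair 𝕜 X Y T X' Y' T' (fun e => (u e).1) (fun e => (u e).2) a)
    (hv : FlatPair 𝕜 X Y T X' Y' T' (fun e => (v e).1) (fun e => (v e).2) a) :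
    HasFDerivAt (wronskian u v) (wronskian u v a •
      ((1 / 3 : ℂ) • ((X a)⁻¹ • X' + (Y a)⁻¹ • Y' + (T a)⁻¹ • T'))) a := by
  refine ((hu.fst.mul hv.snd).sub (hu.snd.mul hv.fst)).congr_fderiv ?_
  ext w
  simp [KZ.wronskian]
  ring

end FlatPair

section Comp

variable {E : Type*} [NormedAddCommGroup E] [NormedSpace ℝ E]
  {V : Type*} [NormedAddCommGroup V] [NormedSpace ℂ V] [NormedSpace ℝ V] [IsScalarTower ℝ ℂ V]

/-- Restriction of a solution to a real submanifold. -/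
theorem FlatPair.comp {X Y T : V → ℂ} {X' Y' T' : V →L[ℂ] ℂ} {c : E → V} {c' : E →L[ℝ] V} {a : E}
    {p q : V → ℂ} (hp : FlatPair ℂ X Y T X' Y' T' p q (c a)) (hc : HasFDerivAt c c' a) :
    FlatPair ℝ (X ∘ c) (Y ∘ c) (T ∘ c) (X'.restrictScalars ℝ ∘L c') (Y'.restrictScalars ℝ ∘L c')
      (T'.restrictScalars ℝ ∘L c') (p ∘ c) (q ∘ c) a := by
  constructor
  · refine ((hp.fst.restrictScalars ℝ).comp a hc).congr_fderiv ?_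
    ext v; simp
  · refine ((hp.snd.restrictScalars ℝ).comp a hc).congr_fderiv ?_
    ext v; simp

end Comp

section Const

variable {E : Type*} [NormedAddCommGroup E] [NormedSpace ℝ E]

/-- The coefficients of `w` in the basis `u, v` of `ℂ²`, by Cramer's rule. -/
def cramer (u v w : ℂ × ℂ) : ℂ × ℂ :=
  ((w.1 * v.2 - w.2 * v.1) / (u.1 * v.2 - u.2 * v.1),
    (u.1 * w.2 - u.2 * w.1) / (u.1 * v.2 - u.2 * v.1))

theorem cramer_combination {u v w : ℂ × ℂ} (huv : u.1 * v.2 - u.2 * v.1 ≠ 0) :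
    (cramer u v w).1 • u + (cramer u v w).2 • v = w := by
  ext
  · simp only [cramer, Prod.fst_add, Prod.smul_fst, smul_eq_mul]
    rw [div_mul_eq_mul_div, div_mul_eq_mul_div, ← add_div, div_eq_iff huv]
    ring
  · simp only [cramer, Prod.snd_add, Prod.smul_snd, smul_eq_mul]
    rw [div_mul_eq_mul_div, div_mul_eq_mul_div, ← add_div, div_eq_iff huv]
    ring

theorem cramer_of_combination {u v : ℂ × ℂ} (huv : u.1 * v.2 - u.2 * v.1 ≠ 0) (c : ℂ × ℂ) :
    cramer u v (c.1 • u + c.2 • v) = c := by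
  ext
  · simp only [cramer, Prod.fst_add, Prod.snd_add, Prod.smul_fst, Prod.smul_snd, smul_eq_mul]
    rw [div_eq_iff huv]
    ring
  · simp only [cramer, Prod.fst_add, Prod.snd_add, Prod.smul_fst, Prod.smul_snd, smul_eq_mul]
    rw [div_eq_iff huv]
    ring

/-- Two functions with the same logarithmic derivative are proportional. -/
theorem div_eq_div_of_hasFDerivAt {S : Set E} (hS : IsOpen S) (hS' : Convex ℝ S) {N D : E → ℂ}
    {τ : E → E →L[ℝ] ℂ} (hN : ∀ e ∈ S, HasFDerivAt N (N e • τ e) e)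
    (hD : ∀ e ∈ S, HasFDerivAt D (D e • τ e) e) (hD0 : ∀ e ∈ S, D e ≠ 0) {x y : E}
    (hx : x ∈ S) (hy : y ∈ S) : N x / D x = N y / D y := by
  have key : ∀ e ∈ S, HasFDerivAt (fun e => N e * (D e)⁻¹) (0 : E →L[ℝ] ℂ) e := by
    intro e he
    have h1 : HasFDerivAt (fun e => (D e)⁻¹) (-(D e ^ 2)⁻¹ • (D e • τ e)) e :=
      ((hasDerivAt_inv (hD0 e he)).comp_hasFDerivAt e (hD e he))
    refine ((hN e he).mul h1).congr_fderiv ?_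
    have := hD0 e he
    ext v
    simp
    field_simp
    ring
  have := hS.is_const_of_fderiv_eq_zero (𝕜 := ℝ) hS'.isPreconnected
    (fun e he => (key e he).differentiableAt.differentiableWithinAt)
    (fun e he => (key e he).fderiv) hx hy
  simpa [div_eq_mul_inv] using this

/-- The coefficients of a solution in a basis of solutions are constant. -/
theorem cramer_const {S : Set E} (hS : IsOpen S) (hS' : Convex ℝ S) {X Y T : E → ℂ}
    {X' Y' T' : E → E →L[ℝ] ℂ} {u v w : E → ℂ × ℂ}
    (hu : ∀ e ∈ S, FlatPair ℝ X Y T (X' e) (Y' e) (T' e) (fun e => (u e).1) (fun e => (u e).2) e)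
    (hv : ∀ e ∈ S, FlatPair ℝ X Y T (X' e) (Y' e) (T' e) (fun e => (v e).1) (fun e => (v e).2) e)
    (hw : ∀ e ∈ S, FlatPair ℝ X Y T (X' e) (Y' e) (T' e) (fun e => (w e).1) (fun e => (w e).2) e)
    (h0 : ∀ e ∈ S, (u e).1 * (v e).2 - (u e).2 * (v e).1 ≠ 0) {x y : E} (hx : x ∈ S) (hy : y ∈ S) :
    cramer (u x) (v x) (w x) = cramer (u y) (v y) (w y) :=
  Prod.ext
    (div_eq_div_of_hasFDerivAt hS hS' (fun e he => (hw e he).wronskian (hv e he))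
      (fun e he => (hu e he).wronskian (hv e he)) h0 hx hy)
    (div_eq_div_of_hasFDerivAt hS hS' (fun e he => (hu e he).wronskian (hw e he))
      (fun e he => (hu e he).wronskian (hv e he)) h0 hx hy)

end Const

/-! ### The configuration space of four points -/

/-- The product `(z₁ - z₂) (z₃ - z₄)`. -/
def crossX (z : Fin 4 → ℂ) : ℂ := (z 0 - z 1) * (z 2 - z 3)

/-- The product `(z₁ - z₃) (z₂ - z₄)`. -/
def crossY (z : Fin 4 → ℂ) : ℂ := (z 0 - z 2) * (z 1 - z 3)

/-- The product `(z₁ - z₄) (z₂ - z₃)`. -/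
def crossT (z : Fin 4 → ℂ) : ℂ := (z 0 - z 3) * (z 1 - z 2)

/-- The differential of `crossX`. -/
def crossX' (z : Fin 4 → ℂ) : (Fin 4 → ℂ) →L[ℂ] ℂ :=
  (z 0 - z 1) • (.proj 2 - .proj 3) + (z 2 - z 3) • (.proj 0 - .proj 1)

/-- The differential of `crossY`. -/
def crossY' (z : Fin 4 → ℂ) : (Fin 4 → ℂ) →L[ℂ] ℂ :=
  (z 0 - z 2) • (.proj 1 - .proj 3) + (z 1 - z 3) • (.proj 0 - .proj 2)

/-- The differential of `crossT`. -/
def crossT' (z : Fin 4 → ℂ) : (Fin 4 → ℂ) →L[ℂ] ℂ :=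
  (z 0 - z 3) • (.proj 1 - .proj 2) + (z 1 - z 2) • (.proj 0 - .proj 3)

theorem injective_iff_cross (z : Fin 4 → ℂ) :
    Function.Injective z ↔ crossX z ≠ 0 ∧ crossY z ≠ 0 ∧ crossT z ≠ 0 := by
  constructor
  · intro hz
    have : ∀ i j : Fin 4, i ≠ j → z i - z j ≠ 0 := fun i j hij =>
      sub_ne_zero.2 (hz.ne hij)
    exact ⟨mul_ne_zero (this _ _ (by decide)) (this _ _ (by decide)),
      mul_ne_zero (this _ _ (by decide)) (this _ _ (by decide)),
      mul_ne_zero (this _ _ (by decide)) (this _ _ (by decide))⟩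
  · rintro ⟨h1, h2, h3⟩
    simp only [crossX, crossY, crossT, mul_ne_zero_iff, sub_ne_zero] at h1 h2 h3
    intro i j hij
    fin_cases i <;> fin_cases j <;> first | rfl | (exfalso; simp at hij; simp_all)

theorem cross_conf {z : Fin 4 → ℂ} (hz : Function.Injective z) :
    Cross ℂ crossX crossY crossT (crossX' z) (crossY' z) (crossT' z) z := by
  have hp : ∀ i j : Fin 4, HasFDerivAt (fun z : Fin 4 → ℂ => z i - z j)
      ((.proj i : (Fin 4 → ℂ) →L[ℂ] ℂ) - .proj j) z := fun i j =>
    (hasFDerivAt_apply i z).sub (hasFDerivAt_apply j z)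
  obtain ⟨h1, h2, h3⟩ := (injective_iff_cross z).1 hz
  refine ⟨(hp 0 1).mul (hp 2 3), (hp 0 2).mul (hp 1 3), (hp 0 3).mul (hp 1 2), ?_, ?_, h1, h2, h3⟩
  · simp only [crossX, crossY, crossT]; ring
  · ext v
    simp [crossX', crossY', crossT']
    ring

/-- A section of the bundle of coinvariants given by its coordinates is flat at a point. -/
abbrev FlatPairConf (u : (Fin 4 → ℂ) → ℂ × ℂ) (z : Fin 4 → ℂ) : Prop :=
  FlatPair ℂ crossX crossY crossT (crossX' z) (crossY' z) (crossT' z)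
    (fun w => (u w).1) (fun w => (u w).2) z

/-- The connection matrix in coordinates, through the logarithmic derivatives of the three products
of differences. -/
theorem coord_kzMatrix {z : Fin 4 → ℂ} (hz : Function.Injective z) (j : Fin 4)
    (u : Coinvariants 4) : coord (kzMatrix 3 z j u) = (1 / 3 : ℂ) •
      ((crossX' z (Pi.single j 1) / crossX z) •
          ((coord u).1 / 2 - (coord u).2, -3 / 2 * (coord u).2) +
        (crossY' z (Pi.single j 1) / crossY z) •
          (-3 / 2 * (coord u).1, (coord u).2 / 2 - (coord u).1) +
        (crossT' z (Pi.single j 1) / crossT z) •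
          ((coord u).2 - (coord u).1 / 2, (coord u).1 - (coord u).2 / 2)) := by
  have hs : ∀ i j : Fin 4, i ≠ j → z i - z j ≠ 0 := fun i j hij =>
      sub_ne_zero.2 (hz.ne hij)
  have e0 : (Finset.univ : Finset (Fin 4)).erase 0 = {1, 2, 3} := by decide
  have e1 : (Finset.univ : Finset (Fin 4)).erase 1 = {0, 2, 3} := by decide
  have e2 : (Finset.univ : Finset (Fin 4)).erase 2 = {0, 1, 3} := by decide
  have e3 : (Finset.univ : Finset (Fin 4)).erase 3 = {0, 1, 2} := by decide
  have h01 := hs 0 1 (by decide)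
  have h02 := hs 0 2 (by decide)
  have h03 := hs 0 3 (by decide)
  have h12 := hs 1 2 (by decide)
  have h13 := hs 1 3 (by decide)
  have h23 := hs 2 3 (by decide)
  have i01 : (z 1 - z 0)⁻¹ = -(z 0 - z 1)⁻¹ := by rw [← neg_sub, inv_neg]
  have i02 : (z 2 - z 0)⁻¹ = -(z 0 - z 2)⁻¹ := by rw [← neg_sub, inv_neg]
  have i03 : (z 3 - z 0)⁻¹ = -(z 0 - z 3)⁻¹ := by rw [← neg_sub, inv_neg]
  have i12 : (z 2 - z 1)⁻¹ = -(z 1 - z 2)⁻¹ := by rw [← neg_sub, inv_neg]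
  have i13 : (z 3 - z 1)⁻¹ = -(z 1 - z 3)⁻¹ := by rw [← neg_sub, inv_neg]
  have i23 : (z 3 - z 2)⁻¹ = -(z 2 - z 3)⁻¹ := by rw [← neg_sub, inv_neg]
  have four : ∀ j : Fin 4, j = 0 ∨ j = 1 ∨ j = 2 ∨ j = 3 := by decide
  rw [kzMatrix]
  rcases four j with rfl | rfl | rfl | rfl
  · rw [e0]
    simp [coord_casimirCoinv_fst (j := 0) (k := 1) (by decide),
      coord_casimirCoinv_snd (j := 0) (k := 2) (by decide),
      coord_casimirCoinv_thd (j := 0) (k := 3) (by decide), crossX', crossY', crossT',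
      crossX, crossY, crossT]
    constructor <;> field_simp <;> ring
  · rw [e1]
    simp [coord_casimirCoinv_fst (j := 1) (k := 0) (by decide),
      coord_casimirCoinv_snd (j := 1) (k := 3) (by decide),
      coord_casimirCoinv_thd (j := 1) (k := 2) (by decide), crossX', crossY', crossT',
      crossX, crossY, crossT, i01]
    constructor <;> field_simp <;> ring
  · rw [e2]
    simp [coord_casimirCoinv_fst (j := 2) (k := 3) (by decide),
      coord_casimirCoinv_snd (j := 2) (k := 0) (by decide),
      coord_casimirCoinv_thd (j := 2) (k := 1) (by decide), crossX', crossY', crossT',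
      crossX, crossY, crossT, i02, i12]
    constructor <;> field_simp <;> ring
  · rw [e3]
    simp [coord_casimirCoinv_fst (j := 3) (k := 2) (by decide),
      coord_casimirCoinv_snd (j := 3) (k := 1) (by decide),
      coord_casimirCoinv_thd (j := 3) (k := 0) (by decide), crossX', crossY', crossT',
      crossX, crossY, crossT, i03, i13, i23]
    constructor <;> field_simp <;> ring

theorem isFlatSection_iff {U : Set (Fin 4 → ℂ)} (hU : ∀ z ∈ U, Function.Injective z)
    (u : (Fin 4 → ℂ) → Coinvariants 4) :
    IsFlatSection 3 U u ↔ ∀ z ∈ U, FlatPairConf (fun w => coord (u w)) z := by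
  -- the differential prescribed for a linear functional of the two coordinates
  have key : ∀ z ∈ U, ∀ ψ : (ℂ × ℂ) →ₗ[ℂ] ℂ,
      (∑ j : Fin 4, (-ψ (coord (kzMatrix 3 z j (u z)))) •
        (ContinuousLinearMap.proj j : (Fin 4 → ℂ) →L[ℂ] ℂ)) =
      (-(1 / 3) : ℂ) • ((ψ ((coord (u z)).1 / 2 - (coord (u z)).2, -3 / 2 * (coord (u z)).2) /
          crossX z) • crossX' z +
        (ψ (-3 / 2 * (coord (u z)).1, (coord (u z)).2 / 2 - (coord (u z)).1) /
          crossY z) • crossY' z +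
        (ψ ((coord (u z)).2 - (coord (u z)).1 / 2, (coord (u z)).1 - (coord (u z)).2 / 2) /
          crossT z) • crossT' z) := by
    intro z hz ψ
    apply ContinuousLinearMap.coe_injective
    refine LinearMap.pi_ext' fun j => ?_
    ext
    simp only [LinearMap.comp_apply, LinearMap.coe_single, ContinuousLinearMap.coe_coe,
      sum_apply, smul_apply, ContinuousLinearMap.proj_apply,
      add_apply, smul_eq_mul]
    rw [Finset.sum_eq_single j (fun k _ hk => by simp [hk]) (by simp), coord_kzMatrix (hU z hz),
      map_smul, map_add, map_add, map_smul, map_smul, map_smul]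
    simp only [Pi.single_eq_same, smul_eq_mul]
    ring
  constructor
  · intro h z hz
    refine ⟨?_, ?_⟩
    · have h1 := h z hz (LinearMap.fst ℂ ℂ ℂ ∘ₗ coord.toLinearMap)
      refine h1.congr_fderiv ?_
      exact key z hz (LinearMap.fst ℂ ℂ ℂ)
    · have h1 := h z hz (LinearMap.snd ℂ ℂ ℂ ∘ₗ coord.toLinearMap)
      refine h1.congr_fderiv ?_
      exact key z hz (LinearMap.snd ℂ ℂ ℂ)
  · intro h z hz φ
    obtain ⟨A, B, hφ⟩ : ∃ A B : ℂ, ∀ v : Coinvariants 4,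
        φ v = A * (coord v).1 + B * (coord v).2 := by
      refine ⟨φ (coord.symm (1, 0)), φ (coord.symm (0, 1)), fun v => ?_⟩
      have : v = (coord v).1 • coord.symm (1, 0) + (coord v).2 • coord.symm (0, 1) := by
        apply coord.injective
        rw [map_add, map_smul, map_smul]
        simp
      conv_lhs => rw [this]
      simp [mul_comm]
    let ψ : (ℂ × ℂ) →ₗ[ℂ] ℂ := φ ∘ₗ coord.symm.toLinearMap
    have h1 := key z hz ψ
    simp only [ψ, LinearMap.comp_apply, LinearEquiv.coe_coe, LinearEquiv.symm_apply_apply] at h1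
    rw [h1]
    simp only [hφ, LinearEquiv.apply_symm_apply]
    refine (((h z hz).fst.const_mul A).add ((h z hz).snd.const_mul B)).congr_fderiv ?_
    ext v
    simp
    ring

/-! ### Local bases of flat sections -/

section Local

variable {E : Type*} [NormedAddCommGroup E] [NormedSpace ℂ E]
  {X Y T : E → ℂ} {X' Y' T' : E →L[ℂ] ℂ} {a : E}

/-- A branch of `(XYT)^{-1/6}`. -/
theorem Cross.hasFDerivAt_root (hc : Cross ℂ X Y T X' Y' T' a) {m : ℂ}
    (hm : X a * Y a * T a / m ∈ Complex.slitPlane) :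
    HasFDerivAt (fun e => Complex.exp (-(1 / 6) * Complex.log (X e * Y e * T e / m)))
      ((-(1 / 6) * Complex.exp (-(1 / 6) * Complex.log (X a * Y a * T a / m)) : ℂ) •
      ((X a)⁻¹ • X' + (Y a)⁻¹ • Y' + (T a)⁻¹ • T')) a := by
  have m0 : m ≠ 0 := by
    rintro rfl
    simp at hm
  have h1 : HasFDerivAt (fun e => X e * Y e * T e / m) _ a :=
    ((hc.hX.mul hc.hY).mul hc.hT).mul_const m⁻¹
  have h2 := ((h1.clog hm).const_mul (-(1 / 6) : ℂ)).cexp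
  refine h2.congr_fderiv ?_
  have := hc.X_ne
  have := hc.Y_ne
  have := hc.T_ne
  ext v
  simp
  field_simp
  ring

/-- A primitive in the cross ratio `l = Y / T` of a branch of `l^{-1/3} (l - 1)^{-4/3}` provides a
solution of the KZ system which is not on the invariant line. -/
theorem Cross.flatPair_of_crossRatio (hc : Cross ℂ X Y T X' Y' T' a) {g : E → ℂ}
    (hg : HasFDerivAt g ((-(1 / 6) * g a : ℂ) •
      ((X a)⁻¹ • X' + (Y a)⁻¹ • Y' + (T a)⁻¹ • T')) a) {F b : ℂ → ℂ} {l : ℂ}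
    (hl : l = Y a * (T a)⁻¹)
    (hF : HasDerivAt F (b l) l) (hb : HasDerivAt b (b l * (-(1 / 3) / l - 4 / 3 / (l - 1))) l) :
    FlatPair ℂ X Y T X' Y' T'
      (fun e => g e * (F (Y e * (T e)⁻¹) * Y e + 3 * X e * (Y e * (T e)⁻¹) * b (Y e * (T e)⁻¹)))
      (fun e => g e * (F (Y e * (T e)⁻¹) * X e)) a := by
  have X0 := hc.X_ne
  have Y0 := hc.Y_ne
  have T0 := hc.T_ne
  have hT : HasFDerivAt (fun e => (T e)⁻¹) (-(T a ^ 2)⁻¹ • T') a :=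
    (hasDerivAt_inv T0).comp_hasFDerivAt a hc.hT
  have hl' := hc.hY.mul hT
  subst hl
  have hF' := hF.comp_hasFDerivAt a hl'
  have hb' := hb.comp_hasFDerivAt a hl'
  refine hc.flatPair hg (β := fun e => 3 * X e * (Y e * (T e)⁻¹) * b (Y e * (T e)⁻¹)) ?_ ?_
  · refine hF'.congr_fderiv ?_
    ext v
    simp
    field_simp
    ring
  · refine (((hc.hX.const_mul 3).mul hl').mul hb').congr_fderiv ?_
    have e1 : Y a * (T a)⁻¹ - 1 = X a / T a := by
      rw [hc.eq]; field_simp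
    rw [e1]
    ext v
    have e2 : X' v = Y' v - T' v := by rw [hc.eq']; rfl
    have e3 : T a = Y a - X a := by rw [hc.eq]; ring
    simp
    rw [e2]
    generalize Y' v = y
    generalize T' v = t
    generalize b _ = b
    field_simp
    rw [e3]
    ring

end Local

/-- Local existence of a branch `b` of `l^{-1/3} (l - 1)^{-4/3}`, up to a factor, together with a
primitive `F`. -/
theorem exists_local_primitive {l₀ : ℂ} (h0 : l₀ ≠ 0) (h1 : l₀ ≠ 1) :
    ∃ r > 0, ∃ F b : ℂ → ℂ, ∀ l ∈ Metric.ball l₀ r, HasDerivAt F (b l) l ∧ b l ≠ 0 ∧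
      HasDerivAt b (b l * (-(1 / 3) / l - 4 / 3 / (l - 1))) l := by
  have h1' : l₀ - 1 ≠ 0 := sub_ne_zero.2 h1
  have hr : 0 < min ‖l₀‖ ‖l₀ - 1‖ := lt_min (norm_pos_iff.2 h0) (norm_pos_iff.2 h1')
  set b : ℂ → ℂ := fun l => Complex.exp (-(1 / 3) * Complex.log (l / l₀) -
    4 / 3 * Complex.log ((l - 1) / (l₀ - 1))) with hb
  have slit : ∀ m m₀ : ℂ, m₀ ≠ 0 → ‖m - m₀‖ < ‖m₀‖ → m / m₀ ∈ Complex.slitPlane := by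
    intro m m₀ hm h
    have : m / m₀ = 1 + (m - m₀) / m₀ := by field_simp; ring
    rw [this]
    apply Complex.mem_slitPlane_of_norm_lt_one
    rwa [norm_div, div_lt_one (norm_pos_iff.2 hm)]
  have key : ∀ l ∈ Metric.ball l₀ (min ‖l₀‖ ‖l₀ - 1‖),
      HasDerivAt b (b l * (-(1 / 3) / l - 4 / 3 / (l - 1))) l := by
    intro l hl
    rw [mem_ball_iff_norm, lt_min_iff] at hl
    have s1 := slit l l₀ h0 hl.1
    have s2 := slit (l - 1) (l₀ - 1) h1' (by simpa using hl.2)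
    have d1 := (((hasDerivAt_id l).div_const l₀).clog s1).const_mul (-(1 / 3) : ℂ)
    have d2 := ((((hasDerivAt_id l).sub_const 1).div_const (l₀ - 1)).clog s2).const_mul (4 / 3 : ℂ)
    refine (d1.sub d2).cexp.congr_deriv ?_
    have n1 := Complex.slitPlane_ne_zero s1
    have n2 := Complex.slitPlane_ne_zero s2
    simp only [ne_eq, div_eq_zero_iff, not_or] at n1 n2
    obtain ⟨n1, -⟩ := n1
    obtain ⟨n2, -⟩ := n2
    simp only [id, hb, Pi.sub_apply]
    congr 1
    field_simp
  obtain ⟨F, hF⟩ := DifferentiableOn.isExactOn_ball (f := b) fun l hl =>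
    (key l hl).differentiableAt.differentiableWithinAt
  exact ⟨_, hr, F, b, fun l hl => ⟨hF l hl, Complex.exp_ne_zero _, key l hl⟩⟩

/-- A basis of flat sections, in coordinates, on a ball in the configuration space, the first of
them being on the invariant line. -/
structure Frame (z₀ : Fin 4 → ℂ) where
  r : ℝ
  r_pos : 0 < r
  inj : ∀ z ∈ Metric.ball z₀ r, Function.Injective z
  u : (Fin 4 → ℂ) → ℂ × ℂ
  v : (Fin 4 → ℂ) → ℂ × ℂ
  flat_u : ∀ z ∈ Metric.ball z₀ r, FlatPairConf u z
  flat_v : ∀ z ∈ Metric.ball z₀ r, FlatPairConf v z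
  indep : ∀ z ∈ Metric.ball z₀ r, (u z).1 * (v z).2 - (u z).2 * (v z).1 ≠ 0
  line : ∀ z ∈ Metric.ball z₀ r, ∃ g : ℂ, u z = (g * crossY z, g * crossX z)

theorem continuous_crossX : Continuous crossX := by unfold crossX; fun_prop
theorem continuous_crossY : Continuous crossY := by unfold crossY; fun_prop
theorem continuous_crossT : Continuous crossT := by unfold crossT; fun_prop

theorem nonempty_frame {z₀ : Fin 4 → ℂ} (hz : Function.Injective z₀) : Nonempty (Frame z₀) := by
  obtain ⟨X0, Y0, T0⟩ := (injective_iff_cross z₀).1 hz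
  have l0 : crossY z₀ * (crossT z₀)⁻¹ ≠ 0 := mul_ne_zero Y0 (inv_ne_zero T0)
  have l1 : crossY z₀ * (crossT z₀)⁻¹ ≠ 1 := by
    rw [← div_eq_mul_inv, ne_eq, div_eq_one_iff_eq T0, ← sub_eq_zero, ← (cross_conf hz).eq]
    exact X0
  obtain ⟨ρ, hρ, F, b, hF⟩ := exists_local_primitive l0 l1
  set m := crossX z₀ * crossY z₀ * crossT z₀ with hm
  have m0 : m ≠ 0 := mul_ne_zero (mul_ne_zero X0 Y0) T0
  have cX := continuous_crossX
  have cY := continuous_crossY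
  have cT := continuous_crossT
  have n1 : ∀ᶠ z in 𝓝 z₀, Function.Injective z := by
    filter_upwards [cX.continuousAt.eventually_ne X0, cY.continuousAt.eventually_ne Y0,
      cT.continuousAt.eventually_ne T0] with z h1 h2 h3
    exact (injective_iff_cross z).2 ⟨h1, h2, h3⟩
  have n2 : ∀ᶠ z in 𝓝 z₀, crossX z * crossY z * crossT z / m ∈ Complex.slitPlane := by
    have c : ContinuousAt (fun z => crossX z * crossY z * crossT z / m) z₀ := by fun_prop
    refine c.eventually_mem (Complex.isOpen_slitPlane.mem_nhds ?_)
    rw [← hm, div_self m0]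
    exact Complex.one_mem_slitPlane
  have n3 : ∀ᶠ z in 𝓝 z₀, crossY z * (crossT z)⁻¹ ∈
      Metric.ball (crossY z₀ * (crossT z₀)⁻¹) ρ := by
    have c : ContinuousAt (fun z => crossY z * (crossT z)⁻¹) z₀ :=
      cY.continuousAt.mul (cT.continuousAt.inv₀ T0)
    exact c.eventually_mem (Metric.ball_mem_nhds _ hρ)
  obtain ⟨r, hr, h⟩ := Metric.eventually_nhds_iff_ball.1 (n1.and (n2.and n3))
  let g : (Fin 4 → ℂ) → ℂ := fun z =>
    Complex.exp (-(1 / 6) * Complex.log (crossX z * crossY z * crossT z / m))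
  have g0 : ∀ z, g z ≠ 0 := fun z => Complex.exp_ne_zero _
  have hg := fun z hz => (cross_conf (h z hz).1).hasFDerivAt_root (h z hz).2.1
  refine ⟨⟨r, hr, fun z hz => (h z hz).1, fun z => (g z * crossY z, g z * crossX z),
    fun z => (g z * (F (crossY z * (crossT z)⁻¹) * crossY z +
      3 * crossX z * (crossY z * (crossT z)⁻¹) * b (crossY z * (crossT z)⁻¹)),
      g z * (F (crossY z * (crossT z)⁻¹) * crossX z)), fun z hz => ?_, fun z hz => ?_,
      fun z hz => ?_, fun z hz => ⟨g z, rfl⟩⟩⟩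
  · have := (cross_conf (h z hz).1).flatPair (hg z hz) (F := fun _ => 1) (β := fun _ => 0)
      ((hasFDerivAt_const (1 : ℂ) z).congr_fderiv (by ext; simp))
      ((hasFDerivAt_const (0 : ℂ) z).congr_fderiv (by ext; simp))
    simpa only [one_mul, add_zero] using this
  · exact (cross_conf (h z hz).1).flatPair_of_crossRatio (hg z hz) rfl
      (hF _ (h z hz).2.2).1 (hF _ (h z hz).2.2).2.2
  · obtain ⟨X0, Y0, T0⟩ := (injective_iff_cross z).1 (h z hz).1
    have b0 := (hF _ (h z hz).2.2).2.1
    have e : ∀ g X Y F β : ℂ, g * Y * (g * (F * X)) - g * X * (g * (F * Y + β)) =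
        -(g * g * X * β) := fun g X Y F β => by ring
    simp only [e]
    refine neg_ne_zero.2 (mul_ne_zero (mul_ne_zero (mul_ne_zero (g0 z) (g0 z)) X0) ?_)
    exact mul_ne_zero (mul_ne_zero (mul_ne_zero three_ne_zero X0)
      (mul_ne_zero Y0 (inv_ne_zero T0))) b0

/-- A chosen basis of flat sections near a configuration. -/
def frame (z : Conf 4) : Frame z.1 := (nonempty_frame z.2).some

theorem Frame.flat_comb {z₀ : Fin 4 → ℂ} (Φ : Frame z₀) (c : ℂ × ℂ) {z : Fin 4 → ℂ}
    (hz : z ∈ Metric.ball z₀ Φ.r) : FlatPairConf (fun z => c.1 • Φ.u z + c.2 • Φ.v z) z :=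
  ((Φ.flat_u z hz).smul c.1).add ((Φ.flat_v z hz).smul c.2)

/-- The coefficients in a local basis of flat sections are constant for every solution of the KZ
system along a real submanifold. -/
theorem Frame.cramer_const {z₀ : Fin 4 → ℂ} (Φ : Frame z₀) {E : Type*} [NormedAddCommGroup E]
    [NormedSpace ℝ E] {S : Set E} (hS : IsOpen S) (hS' : Convex ℝ S) {c : E → Fin 4 → ℂ}
    {c' : E → E →L[ℝ] (Fin 4 → ℂ)} (hc : ∀ e ∈ S, HasFDerivAt c (c' e) e)
    (hcS : ∀ e ∈ S, c e ∈ Metric.ball z₀ Φ.r) {w : E → ℂ × ℂ}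
    (hw : ∀ e ∈ S, FlatPair ℝ (crossX ∘ c) (crossY ∘ c) (crossT ∘ c)
      ((crossX' (c e)).restrictScalars ℝ ∘L c' e) ((crossY' (c e)).restrictScalars ℝ ∘L c' e)
      ((crossT' (c e)).restrictScalars ℝ ∘L c' e) (fun e => (w e).1) (fun e => (w e).2) e)
    {x y : E} (hx : x ∈ S) (hy : y ∈ S) :
    cramer (Φ.u (c x)) (Φ.v (c x)) (w x) = cramer (Φ.u (c y)) (Φ.v (c y)) (w y) :=
  KZ.cramer_const hS hS' (u := Φ.u ∘ c) (v := Φ.v ∘ c)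
    (fun e he => (Φ.flat_u _ (hcS e he)).comp (hc e he))
    (fun e he => (Φ.flat_v _ (hcS e he)).comp (hc e he)) hw
    (fun e he => Φ.indep _ (hcS e he)) hx hy

/-- The coefficients in a local basis of flat sections are constant for every flat section. -/
theorem Frame.cramer_const_of_flat {z₀ : Fin 4 → ℂ} (Φ : Frame z₀) {S : Set (Fin 4 → ℂ)}
    (hS : IsOpen S) (hS' : Convex ℝ S) (hcS : S ⊆ Metric.ball z₀ Φ.r) {w : (Fin 4 → ℂ) → ℂ × ℂ}
    (hw : ∀ z ∈ S, FlatPairConf w z) {x y : Fin 4 → ℂ} (hx : x ∈ S) (hy : y ∈ S) :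
    cramer (Φ.u x) (Φ.v x) (w x) = cramer (Φ.u y) (Φ.v y) (w y) :=
  Φ.cramer_const hS hS' (c := id) (c' := fun _ => .id ℝ _) (fun e _ => hasFDerivAt_id e) hcS
    (fun e he => (hw e he).comp (hasFDerivAt_id e)) hx hy

/-! ### The covering space of germs of flat sections -/

/-- The fibre `ℂ²` with the discrete topology. -/
def DiscretePlane : Type := ℂ × ℂ

instance : TopologicalSpace DiscretePlane := ⊥

instance : DiscreteTopology DiscretePlane := ⟨rfl⟩

theorem continuousAt_discretePlane {α : Type*} [TopologicalSpace α] {f : α → DiscretePlane}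
    {a : α} : ContinuousAt f a ↔ ∀ᶠ x in 𝓝 a, f x = f a := by
  rw [ContinuousAt, nhds_discrete DiscretePlane, Filter.tendsto_pure]

/-- The coefficients of a vector at `z` in the local basis of flat sections around `i`. -/
def coef (i : Conf 4) (z : Fin 4 → ℂ) (w : ℂ × ℂ) : DiscretePlane :=
  cramer ((frame i).u z) ((frame i).v z) w

/-- The value at `z` of the flat section with the given coefficients in the local basis of flat
sections around `i`. -/
def comb (i : Conf 4) (z : Fin 4 → ℂ) (c : DiscretePlane) : ℂ × ℂ :=
  Prod.fst (α := ℂ) (β := ℂ) c • (frame i).u z + Prod.snd (α := ℂ) (β := ℂ) c • (frame i).v z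

theorem coef_comb {i : Conf 4} {z : Fin 4 → ℂ} (hz : z ∈ Metric.ball i.1 (frame i).r)
    (c : DiscretePlane) : coef i z (comb i z c) = c :=
  cramer_of_combination ((frame i).indep z hz) c

theorem comb_coef {i : Conf 4} {z : Fin 4 → ℂ} (hz : z ∈ Metric.ball i.1 (frame i).r) (w : ℂ × ℂ) :
    comb i z (coef i z w) = w :=
  cramer_combination ((frame i).indep z hz)

theorem mem_ball_frame (i : Conf 4) : i.1 ∈ Metric.ball i.1 (frame i).r :=
  Metric.mem_ball_self (frame i).r_pos

/-- The transition functions between local bases of flat sections are locally constant. -/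
theorem coef_comb_eq {i j : Conf 4} {y z : Fin 4 → ℂ}
    (hy : y ∈ Metric.ball i.1 (frame i).r ∩ Metric.ball j.1 (frame j).r)
    (hz : z ∈ Metric.ball i.1 (frame i).r ∩ Metric.ball j.1 (frame j).r) (c : DiscretePlane) :
    coef j y (comb i y c) = coef j z (comb i z c) :=
  (frame j).cramer_const_of_flat (w := fun y => comb i y c)
    (Metric.isOpen_ball.inter Metric.isOpen_ball)
    ((convex_ball _ _).inter (convex_ball _ _))
    Set.inter_subset_right (fun _ h => (frame i).flat_comb c h.1) hy hz

theorem continuousOn_coef_comb (i j : Conf 4) :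
    ContinuousOn (fun p : Conf 4 × DiscretePlane => coef j p.1.1 (comb i p.1.1 p.2))
      (({z | z.1 ∈ Metric.ball i.1 (frame i).r} ∩ {z | z.1 ∈ Metric.ball j.1 (frame j).r}) ×ˢ
        Set.univ) := by
  rintro ⟨z, c⟩ ⟨hz, -⟩
  have h1 : ∀ᶠ y : Conf 4 in 𝓝 z,
      y.1 ∈ Metric.ball i.1 (frame i).r ∩ Metric.ball j.1 (frame j).r :=
    continuous_subtype_val.continuousAt.eventually_mem
      ((Metric.isOpen_ball.inter Metric.isOpen_ball).mem_nhds hz)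
  have h2 : ∀ᶠ d : DiscretePlane in 𝓝 c, d = c := by simp [nhds_discrete]
  refine (continuousAt_discretePlane.2 ?_).continuousWithinAt
  rw [nhds_prod_eq]
  filter_upwards [h1.prod_mk h2] with p hp
  rw [hp.2]
  exact coef_comb_eq hp.1 hz c

/-- The flat bundle of coinvariants with discrete fibres: its local trivializations are given by
the coefficients in local bases of flat sections. -/
def flatCore : FiberBundleCore (Conf 4) (Conf 4) DiscretePlane where
  baseSet i := {z | z.1 ∈ Metric.ball i.1 (frame i).r}
  isOpen_baseSet i := Metric.isOpen_ball.preimage continuous_subtype_val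
  indexAt z := z
  mem_baseSet_at z := mem_ball_frame z
  coordChange i j z c := coef j z.1 (comb i z.1 c)
  coordChange_self i z hz c := coef_comb hz c
  continuousOn_coordChange i j := continuousOn_coef_comb i j
  coordChange_comp i j k z hz c := by
    obtain ⟨⟨-, hj⟩, -⟩ := hz
    exact congrArg (coef k z.1) (comb_coef hj _)

theorem isCoveringMap_flatCore : IsCoveringMap flatCore.proj :=
  FiberBundle.isCoveringMap

/-- A vector of the fibre at `z` as a point of the covering space. -/
def toTotal (z : Conf 4) (a : Coinvariants 4) : flatCore.TotalSpace :=
  ⟨z, coef z z.1 (coord a)⟩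

/-- The vector represented by a point of the covering space. -/
def ofTotal (x : flatCore.TotalSpace) : Coinvariants 4 :=
  coord.symm (comb x.1 x.1.1 x.2)

theorem ofTotal_toTotal (z : Conf 4) (a : Coinvariants 4) : ofTotal (toTotal z a) = a := by
  rw [ofTotal, LinearEquiv.symm_apply_eq]
  exact comb_coef (mem_ball_frame z) _

theorem toTotal_ofTotal (x : flatCore.TotalSpace) : toTotal x.1 (ofTotal x) = x := by
  obtain ⟨z, c⟩ := x
  refine congrArg (Bundle.TotalSpace.mk z) ?_
  change coef z z.1 (coord (coord.symm (comb z z.1 c))) = c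
  rw [LinearEquiv.apply_symm_apply]
  exact coef_comb (mem_ball_frame z) _

theorem toTotal_ofTotal_fiber {y : Conf 4} (e : flatCore.proj ⁻¹' {y}) :
    (⟨toTotal y (ofTotal e.1), rfl⟩ : flatCore.proj ⁻¹' {y}) = e := by
  obtain ⟨e, he⟩ := e
  obtain rfl : e.proj = y := he
  exact Subtype.ext (toTotal_ofTotal e)

section Along

variable {x y : Conf 4} {γ : Path x y} {s : unitInterval → Coinvariants 4}

/-- A section along a path is flat if and only if its coefficients in local bases of flat sections
are locally constant. -/
theorem isFlatAlong_iff : IsFlatAlong 3 γ s ↔ ∀ t, ∀ᶠ t' in 𝓝 t,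
    coef (γ t) (γ t').1 (coord (s t')) = coef (γ t) (γ t).1 (coord (s t)) := by
  have hγ : Continuous fun t => (γ t).1 := continuous_subtype_val.comp γ.continuous
  constructor
  · intro h t
    obtain ⟨U, hU, htU, hinj, u, hu, hs⟩ := h t
    obtain ⟨ρ, hρ, hball⟩ := Metric.isOpen_iff.1 (hU.inter Metric.isOpen_ball) _
      ⟨htU, mem_ball_frame (γ t)⟩
    filter_upwards [hs, hγ.continuousAt.eventually_mem (Metric.ball_mem_nhds _ hρ)] with t' h1 h2
    rw [h1, hs.self_of_nhds]
    exact (frame (γ t)).cramer_const_of_flat Metric.isOpen_ball (convex_ball _ _)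
      (fun z hz => (hball hz).2)
      (fun z hz => (isFlatSection_iff hinj u).1 hu z (hball hz).1) h2 (Metric.mem_ball_self hρ)
  · intro h t
    refine ⟨Metric.ball (γ t).1 (frame (γ t)).r, Metric.isOpen_ball, mem_ball_frame _,
      (frame (γ t)).inj, fun z => coord.symm (comb (γ t) z (coef (γ t) (γ t).1 (coord (s t)))),
      ?_, ?_⟩
    · rw [isFlatSection_iff (frame (γ t)).inj]
      intro z hz
      simp only [LinearEquiv.apply_symm_apply]
      exact (frame (γ t)).flat_comb _ hz
    · filter_upwards [h t, hγ.continuousAt.eventually_mem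
        (Metric.isOpen_ball.mem_nhds (mem_ball_frame (γ t)))] with t' h1 h2
      rw [← h1, comb_coef h2, LinearEquiv.symm_apply_apply]

theorem isFlatAlong_iff_continuous :
    IsFlatAlong 3 γ s ↔ Continuous fun t => toTotal (γ t) (s t) := by
  rw [isFlatAlong_iff, continuous_iff_continuousAt]
  refine forall_congr' fun t => ?_
  rw [FiberBundle.continuousAt_totalSpace]
  have h1 : ContinuousAt (fun t => (toTotal (γ t) (s t)).proj) t := γ.continuous.continuousAt
  have h2 : ∀ t', (trivializationAt DiscretePlane flatCore.Fiber (toTotal (γ t) (s t)).proj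
      (toTotal (γ t') (s t'))).2 = coef (γ t) (γ t').1 (coord (s t')) := fun t' =>
    congrArg (coef (γ t) (γ t').1) (comb_coef (mem_ball_frame (γ t')) _)
  rw [and_iff_right h1, continuousAt_discretePlane]
  simp only [h2]

end Along

/-! ### Parallel transport -/

/-- Analytic continuation of flat sections along a homotopy class of paths, as the monodromy of the
covering space of germs of flat sections. -/
def transportFun {x y : Conf 4} (γ : Path.Homotopic.Quotient x y) (a : Coinvariants 4) :
    Coinvariants 4 :=
  ofTotal (isCoveringMap_flatCore.monodromy γ ⟨toTotal x a, rfl⟩)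

theorem transportFun_mk_eq_iff {x y : Conf 4} (γ : Path x y) (a b : Coinvariants 4) :
    transportFun (.mk γ) a = b ↔
      ∃ s : unitInterval → Coinvariants 4, IsFlatAlong 3 γ s ∧ s 0 = a ∧ s 1 = b := by
  have h0 : (γ : C(unitInterval, Conf 4)) 0 = flatCore.proj (toTotal x a) := γ.source
  have hT : transportFun (.mk γ) a = ofTotal (isCoveringMap_flatCore.liftPath γ _ h0 1) := rfl
  rw [hT]
  set Γ := isCoveringMap_flatCore.liftPath γ _ h0 with hΓ
  have hp : ∀ t, (Γ t).proj = γ t := fun t =>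
    congrFun (isCoveringMap_flatCore.liftPath_lifts γ _ h0) t
  constructor
  · rintro rfl
    refine ⟨fun t => ofTotal (Γ t), ?_, ?_, rfl⟩
    · rw [isFlatAlong_iff_continuous]
      convert Γ.continuous using 2 with t
      rw [← hp t, toTotal_ofTotal]
    · change ofTotal (Γ 0) = a
      rw [hΓ, isCoveringMap_flatCore.liftPath_zero, ofTotal_toTotal]
  · rintro ⟨s, hs, rfl, rfl⟩
    rw [isFlatAlong_iff_continuous] at hs
    have : (fun t => toTotal (γ t) (s t)) = Γ := by
      rw [hΓ, isCoveringMap_flatCore.eq_liftPath_iff]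
      exact ⟨hs, rfl, by rw [γ.source]⟩
    rw [← congrFun this 1, ofTotal_toTotal]

theorem IsFlatAlong.add {x y : Conf 4} {γ : Path x y} {s s' : unitInterval → Coinvariants 4}
    (h : IsFlatAlong 3 γ s) (h' : IsFlatAlong 3 γ s') : IsFlatAlong 3 γ fun t => s t + s' t := by
  intro t
  obtain ⟨U, hU, htU, hi, u, hu, hs⟩ := h t
  obtain ⟨U', hU', htU', -, u', hu', hs'⟩ := h' t
  refine ⟨U ∩ U', hU.inter hU', ⟨htU, htU'⟩, fun z hz => hi z hz.1, fun z => u z + u' z, ?_, ?_⟩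
  · rw [isFlatSection_iff fun z hz => hi z hz.1]
    intro z hz
    simp only [map_add]
    exact ((isFlatSection_iff hi u).1 hu z hz.1).add
      ((isFlatSection_iff (U := U ∩ U') (fun z hz => hi z hz.1) u').1
        (fun z hz => hu' z hz.2) z hz)
  · filter_upwards [hs, hs'] with t' h1 h2
    rw [h1, h2]

theorem IsFlatAlong.smul {x y : Conf 4} {γ : Path x y} {s : unitInterval → Coinvariants 4}
    (h : IsFlatAlong 3 γ s) (c : ℂ) : IsFlatAlong 3 γ fun t => c • s t := by
  intro t
  obtain ⟨U, hU, htU, hi, u, hu, hs⟩ := h t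
  refine ⟨U, hU, htU, hi, fun z => c • u z, ?_, ?_⟩
  · rw [isFlatSection_iff hi]
    intro z hz
    simp only [map_smul]
    exact ((isFlatSection_iff hi u).1 hu z hz).smul c
  · filter_upwards [hs] with t' h1
    rw [h1]

theorem transportFun_refl (x : Conf 4) (a : Coinvariants 4) :
    transportFun (.refl x) a = a := by
  rw [transportFun, isCoveringMap_flatCore.monodromy_refl, id, ofTotal_toTotal]

theorem transportFun_trans {x y z : Conf 4} (γ : Path.Homotopic.Quotient x y)
    (δ : Path.Homotopic.Quotient y z) (a : Coinvariants 4) :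
    transportFun (γ.trans δ) a = transportFun δ (transportFun γ a) := by
  rw [transportFun, isCoveringMap_flatCore.monodromy_trans_apply]
  exact congrArg (fun e => ofTotal (isCoveringMap_flatCore.monodromy δ e))
    (toTotal_ofTotal_fiber _).symm

/-- Analytic continuation of flat sections as a linear map. -/
def transport {x y : Conf 4} (γ : Path.Homotopic.Quotient x y) : Module.End ℂ (Coinvariants 4) where
  toFun := transportFun γ
  map_add' a b := by
    obtain ⟨γ⟩ := γ
    obtain ⟨s, hs, h0, h1⟩ := (transportFun_mk_eq_iff γ a _).1 rfl
    obtain ⟨s', hs', h0', h1'⟩ := (transportFun_mk_eq_iff γ b _).1 rfl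
    exact (transportFun_mk_eq_iff γ _ _).2 ⟨_, hs.add hs', by simp only [h0, h0'],
      by simp only [h1, h1']; rfl⟩
  map_smul' c a := by
    obtain ⟨γ⟩ := γ
    obtain ⟨s, hs, h0, h1⟩ := (transportFun_mk_eq_iff γ a _).1 rfl
    exact (transportFun_mk_eq_iff γ _ _).2 ⟨_, hs.smul c, by simp only [h0],
      by simp only [h1]; rfl⟩

theorem transport_mk_eq_iff {x y : Conf 4} (γ : Path x y) (a b : Coinvariants 4) :
    transport (.mk γ) a = b ↔
      ∃ s : unitInterval → Coinvariants 4, IsFlatAlong 3 γ s ∧ s 0 = a ∧ s 1 = b :=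
  transportFun_mk_eq_iff γ a b

theorem transport_refl (x : Conf 4) : transport (.refl x) = 1 :=
  LinearMap.ext (transportFun_refl x)

theorem transport_trans {x y z : Conf 4} (γ : Path.Homotopic.Quotient x y)
    (δ : Path.Homotopic.Quotient y z) : transport (γ.trans δ) = transport δ * transport γ :=
  LinearMap.ext (transportFun_trans γ δ)

/-- The monodromy representation of the KZ connection with `κ = 3`. -/
def monodromyRep (z₀ : Conf 4) :
    Representation ℂ (FundamentalGroup (Conf 4) z₀) (Coinvariants 4) where
  toFun γ := transport (FundamentalGroup.toPath γ)
  map_one' := transport_refl z₀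
  map_mul' γ δ := transport_trans (FundamentalGroup.toPath δ) (FundamentalGroup.toPath γ)

theorem isMonodromy_monodromyRep (z₀ : Conf 4) : IsMonodromy 3 z₀ (monodromyRep z₀) :=
  fun γ a b => transport_mk_eq_iff γ a b

theorem IsMonodromy.eq_monodromyRep {z₀ : Conf 4}
    {ρ : Representation ℂ (FundamentalGroup (Conf 4) z₀) (Coinvariants 4)}
    (h : IsMonodromy 3 z₀ ρ) : ρ = monodromyRep z₀ := by
  refine MonoidHom.ext fun γ => LinearMap.ext fun a => ?_
  obtain ⟨γ⟩ := γ
  exact (h γ a _).2 ((isMonodromy_monodromyRep z₀ γ a _).1 rfl)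

/-! ### Flat sections along explicit curves -/

/-- A differentiable solution of the KZ system along a curve is an analytic continuation of flat
sections. -/
theorem isFlatAlong_of_curve {x y : Conf 4} {γ : Path x y} {c c' : ℝ → Fin 4 → ℂ}
    (hc : ∀ τ, HasDerivAt c (c' τ) τ) (hγ : ∀ t, (γ t).1 = c t) {w : ℝ → ℂ × ℂ}
    (hw : ∀ τ, FlatPair ℝ (crossX ∘ c) (crossY ∘ c) (crossT ∘ c)
      ((crossX' (c τ)).restrictScalars ℝ ∘L .toSpanSingleton ℝ (c' τ))
      ((crossY' (c τ)).restrictScalars ℝ ∘L .toSpanSingleton ℝ (c' τ))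
      ((crossT' (c τ)).restrictScalars ℝ ∘L .toSpanSingleton ℝ (c' τ))
      (fun τ => (w τ).1) (fun τ => (w τ).2) τ) :
    IsFlatAlong 3 γ fun t => coord.symm (w t) := by
  rw [isFlatAlong_iff]
  intro t
  have h1 : ∀ᶠ τ in 𝓝 (t : ℝ), c τ ∈ Metric.ball (γ t).1 (frame (γ t)).r := by
    refine (hc t).continuousAt.eventually_mem (Metric.isOpen_ball.mem_nhds ?_)
    rw [← hγ]
    exact mem_ball_frame _
  obtain ⟨ε, hε, h2⟩ := Metric.eventually_nhds_iff_ball.1 h1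
  filter_upwards [continuous_subtype_val.continuousAt.eventually_mem
    (Metric.ball_mem_nhds (t : ℝ) hε)] with t' ht'
  rw [hγ t', hγ t, LinearEquiv.apply_symm_apply, LinearEquiv.apply_symm_apply]
  exact (frame (γ t)).cramer_const Metric.isOpen_ball (convex_ball _ _)
    (fun τ _ => (hc τ).hasFDerivAt) h2 (fun τ _ => hw τ) ht' (Metric.mem_ball_self hε)

/-- `Cross.flatPair` along a real curve of configurations. -/
theorem flatPair_of_hasDerivAt {c : ℝ → Fin 4 → ℂ} {c' : Fin 4 → ℂ} {τ : ℝ}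
    (hc : HasDerivAt c c' τ) (hinj : Function.Injective (c τ)) {g F β : ℝ → ℂ}
    (hg : HasDerivAt g (-(1 / 6) * g τ * (crossX' (c τ) c' / crossX (c τ) +
      (crossY' (c τ) c' / crossY (c τ) + crossT' (c τ) c' / crossT (c τ)))) τ)
    (hF : HasDerivAt F (β τ / (3 * crossX (c τ)) *
      (crossY' (c τ) c' / crossY (c τ) - crossT' (c τ) c' / crossT (c τ))) τ)
    (hβ : HasDerivAt β (β τ * (2 / 3 * (crossY' (c τ) c' / crossY (c τ) +
      crossT' (c τ) c' / crossT (c τ)) - 1 / 3 * (crossX' (c τ) c' / crossX (c τ)))) τ) :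
    FlatPair ℝ (crossX ∘ c) (crossY ∘ c) (crossT ∘ c)
      ((crossX' (c τ)).restrictScalars ℝ ∘L .toSpanSingleton ℝ c')
      ((crossY' (c τ)).restrictScalars ℝ ∘L .toSpanSingleton ℝ c')
      ((crossT' (c τ)).restrictScalars ℝ ∘L .toSpanSingleton ℝ c')
      (fun τ => g τ * (F τ * crossY (c τ) + β τ)) (fun τ => g τ * (F τ * crossX (c τ))) τ := by
  have h := cross_conf hinj
  have hcross : Cross ℝ (crossX ∘ c) (crossY ∘ c) (crossT ∘ c)
      ((crossX' (c τ)).restrictScalars ℝ ∘L .toSpanSingleton ℝ c')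
      ((crossY' (c τ)).restrictScalars ℝ ∘L .toSpanSingleton ℝ c')
      ((crossT' (c τ)).restrictScalars ℝ ∘L .toSpanSingleton ℝ c') τ :=
    ⟨(h.hX.restrictScalars ℝ).comp τ hc.hasFDerivAt, (h.hY.restrictScalars ℝ).comp τ hc.hasFDerivAt,
      (h.hT.restrictScalars ℝ).comp τ hc.hasFDerivAt, h.eq, by rw [h.eq']; rfl,
      h.X_ne, h.Y_ne, h.T_ne⟩
  refine hcross.flatPair (hg.hasFDerivAt.congr_fderiv ?_) (hF.hasFDerivAt.congr_fderiv ?_)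
    (hβ.hasFDerivAt.congr_fderiv ?_)
  · ext
    simp
    ring
  · ext
    simp
    exact Or.inl (by ring)
  · ext
    simp
    exact Or.inl (by ring)

/-! ### The invariant line -/

/-- The vectors at `z` on the line spanned by `(crossY z, crossX z)`. -/
def invariantLine (z : Fin 4 → ℂ) : Submodule ℂ (Coinvariants 4) where
  carrier := {a | (coord a).1 * crossX z = (coord a).2 * crossY z}
  add_mem' {a b} ha hb := by
    simp only [Set.mem_ofPred_eq, map_add, Prod.fst_add, Prod.snd_add, add_mul] at ha hb ⊢
    rw [ha, hb]
  zero_mem' := by simp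
  smul_mem' c a ha := by
    simp only [Set.mem_ofPred_eq, map_smul, Prod.smul_fst, Prod.smul_snd, smul_eq_mul,
      mul_assoc] at ha ⊢
    rw [ha]

theorem mem_invariantLine {z : Fin 4 → ℂ} {a : Coinvariants 4} :
    a ∈ invariantLine z ↔ (coord a).1 * crossX z = (coord a).2 * crossY z := Iff.rfl

/-- Membership in the invariant line, in terms of coefficients in a local basis. -/
theorem mem_invariantLine_iff_coef {i : Conf 4} {z : Fin 4 → ℂ}
    (hz : z ∈ Metric.ball i.1 (frame i).r) (a : Coinvariants 4) :
    a ∈ invariantLine z ↔ Prod.snd (α := ℂ) (β := ℂ) (coef i z (coord a)) = 0 := by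
  have h := (frame i).indep z hz
  obtain ⟨g, hg⟩ := (frame i).line z hz
  have g0 : g ≠ 0 := by
    rintro rfl
    simp [hg] at h
  have : Prod.snd (α := ℂ) (β := ℂ) (coef i z (coord a)) =
      (((frame i).u z).1 * (coord a).2 - ((frame i).u z).2 * (coord a).1) /
        (((frame i).u z).1 * ((frame i).v z).2 - ((frame i).u z).2 * ((frame i).v z).1) := rfl
  rw [this, div_eq_zero_iff, or_iff_left h, hg, mem_invariantLine]
  constructor
  · intro e
    linear_combination (-g) * e
  · intro e
    refine mul_left_cancel₀ g0 ?_
    linear_combination -e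

/-- The line spanned by `(crossY z, crossX z)` is preserved by parallel transport. -/
theorem transport_mem_invariantLine {x y : Conf 4} (γ : Path x y) {a : Coinvariants 4}
    (ha : a ∈ invariantLine x.1) : transport (.mk γ) a ∈ invariantLine y.1 := by
  obtain ⟨s, hs, h0, h1⟩ := (transport_mk_eq_iff γ a _).1 rfl
  rw [isFlatAlong_iff] at hs
  have hγ : Continuous fun t => (γ t).1 := continuous_subtype_val.comp γ.continuous
  have hloc : IsLocallyConstant fun t => s t ∈ invariantLine (γ t).1 := by
    rw [IsLocallyConstant.iff_eventually_eq]
    intro t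
    filter_upwards [hs t, hγ.continuousAt.eventually_mem
      (Metric.isOpen_ball.mem_nhds (mem_ball_frame (γ t)))] with t' h1 h2
    rw [mem_invariantLine_iff_coef h2, mem_invariantLine_iff_coef (mem_ball_frame (γ t)), h1]
  have := hloc.apply_eq_of_preconnectedSpace 0 1
  rw [γ.source, γ.target, h0, h1] at this
  exact this ▸ ha

/-! ### Two loops -/

open Complex

/-- The non-zero factor `3 - ζ` at `ζ = σ (1 - E)`. -/
def loopM (σ : ℝ) (E : ℂ) : ℂ := 3 - σ + σ * E

/-- The branch of `((2 - E) (3 - σ + σ E))^{-1/3}` which is positive on the real segment. -/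
def loopN (σ : ℝ) (E : ℂ) : ℂ := exp (-(1 / 3) * (log (2 - E) + log (loopM σ E)))

theorem two_sub_mem_slitPlane {E : ℂ} (hE : ‖E‖ < 2) : 2 - E ∈ slitPlane := by
  have := (abs_le.1 (abs_re_le_norm E)).2
  refine mem_slitPlane_iff.2 (Or.inl ?_)
  simp
  linarith

theorem loopM_mem_slitPlane {σ : ℝ} (hσ : σ = 1 ∨ σ = -1) {E : ℂ} (hE : ‖E‖ < 2) :
    loopM σ E ∈ slitPlane := by
  have := abs_le.1 (abs_re_le_norm E)
  refine mem_slitPlane_iff.2 (Or.inl ?_)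
  rcases hσ with rfl | rfl <;> simp [loopM] <;> linarith

theorem hasDerivAt_loopN {σ : ℝ} (hσ : σ = 1 ∨ σ = -1) {E : ℂ} (hE : ‖E‖ < 2) :
    HasDerivAt (loopN σ) (loopN σ E * (-(1 / 3) * (-1 / (2 - E) + σ / loopM σ E))) E := by
  have h1 := ((hasDerivAt_id E).const_sub 2).clog (two_sub_mem_slitPlane hE)
  have h2 : HasDerivAt (loopM σ) σ E :=
    (((hasDerivAt_id E).const_mul (σ : ℂ)).const_add (3 - σ : ℂ)).congr_deriv (mul_one _)
  exact ((h1.add (h2.clog (loopM_mem_slitPlane hσ hE))).const_mul (-(1 / 3) : ℂ)).cexp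

/-- The primitive of `E^{-1/3} ((2 - E) M)^{-1/3} M^{-1}` vanishing at `E = 0`, where `M` is
`loopM σ E`, as a function `H` of `s = E^{1/3}`. The rotation of `s` by a third root of unity
corresponds to a turn of `E` around `0`. -/
theorem exists_loop_primitive {σ : ℝ} (hσ : σ = 1 ∨ σ = -1) : ∃ H : ℂ → ℂ,
    (∀ s, ‖s‖ = 1 → HasDerivAt H (3 * s * (loopN σ (s ^ 3) / loopM σ (s ^ 3))) s) ∧
    (∀ ω : ℂ, ω ^ 3 = 1 → H ω = ω ^ 2 * H 1) ∧ 0 < (H 1).re := by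
  have hcube : ∀ s ∈ Metric.ball (0 : ℂ) (5 / 4), ‖s ^ 3‖ < 2 := by
    intro s hs
    rw [mem_ball_zero_iff] at hs
    rw [norm_pow]
    calc ‖s‖ ^ 3 ≤ (5 / 4) ^ 3 := by gcongr
      _ < 2 := by norm_num
  obtain ⟨H, H0, hH⟩ := (DifferentiableOn.isExactOn_ball
    (f := fun s : ℂ => 3 * s * (loopN σ (s ^ 3) / loopM σ (s ^ 3))) (c := 0) (r := 5 / 4) <| by
      intro s hs
      have h1 : DifferentiableAt ℂ (fun s : ℂ => loopN σ (s ^ 3)) s :=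
        DifferentiableAt.comp (g := loopN σ) (f := fun s => s ^ 3) s
          (hasDerivAt_loopN hσ (hcube s hs)).differentiableAt (by fun_prop)
      have h2 : DifferentiableAt ℂ (fun s : ℂ => loopM σ (s ^ 3)) s := by
        unfold loopM; fun_prop
      exact (DifferentiableAt.mul (by fun_prop) (h1.div h2 (slitPlane_ne_zero
        (loopM_mem_slitPlane hσ (hcube s hs))))).differentiableWithinAt).with_val_at 0 0
  -- the radius `5 / 4` leaves room around the unit circle and has cube less than `2`
  have sphere : ∀ s : ℂ, ‖s‖ = 1 → s ∈ Metric.ball (0 : ℂ) (5 / 4) := by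
    intro s hs
    rw [mem_ball_zero_iff, hs]
    norm_num
  refine ⟨H, fun s hs => hH s (sphere s hs), fun ω hω => ?_, ?_⟩
  · have hω1 : ‖ω‖ = 1 := norm_eq_one_of_pow_eq_one hω three_ne_zero
    have hd : ∀ s ∈ Metric.ball (0 : ℂ) (5 / 4),
        HasDerivAt (fun s => H (ω * s) - ω ^ 2 * H s) 0 s := by
      intro s hs
      have h1 : ω * s ∈ Metric.ball (0 : ℂ) (5 / 4) := by
        rw [mem_ball_zero_iff] at hs ⊢
        rwa [norm_mul, hω1, one_mul]
      have h2 := (hH _ h1).comp s ((hasDerivAt_id s).const_mul ω)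
      refine (h2.sub ((hH s hs).const_mul (ω ^ 2))).congr_deriv ?_
      rw [mul_pow, hω, one_mul]
      ring
    have := Metric.isOpen_ball.is_const_of_deriv_eq_zero
      (convex_ball (0 : ℂ) (5 / 4)).isPreconnected
      (fun s hs => (hd s hs).differentiableAt.differentiableWithinAt)
      (fun s hs => (hd s hs).deriv) (sphere 1 (by simp)) (Metric.mem_ball_self (by norm_num))
    simp only [mul_one, mul_zero, H0, sub_zero] at this
    exact sub_eq_zero.1 this
  · -- on the real segment `H` is real and increasing
    have hd : ∀ x ∈ Set.Icc (0 : ℝ) 1, HasDerivAt (fun x : ℝ => (H x).re)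
        (3 * x * (Real.exp (-(1 / 3) * (Real.log (2 - x ^ 3) +
          Real.log (3 - σ + σ * x ^ 3))) / (3 - σ + σ * x ^ 3))) x := by
      intro x hx
      have hx3 : x ^ 3 ≤ 1 := pow_le_one₀ hx.1 hx.2
      have hx3' : 0 ≤ x ^ 3 := pow_nonneg hx.1 3
      have hb : (x : ℂ) ∈ Metric.ball (0 : ℂ) (5 / 4) := by
        rw [mem_ball_zero_iff, norm_real, Real.norm_of_nonneg hx.1]
        linarith [hx.2]
      refine (hH x hb).real_of_complex.congr_deriv ?_
      have hM : (0 : ℝ) ≤ 3 - σ + σ * x ^ 3 := by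
        rcases hσ with rfl | rfl <;> linarith
      have : (3 * x * (loopN σ (x ^ 3) / loopM σ (x ^ 3)) : ℂ) =
          ((3 * x * (Real.exp (-(1 / 3) * (Real.log (2 - x ^ 3) +
          Real.log (3 - σ + σ * x ^ 3))) / (3 - σ + σ * x ^ 3)) : ℝ) : ℂ) := by
        push_cast [loopN, loopM, ofReal_log (show (0 : ℝ) ≤ 2 - x ^ 3 by linarith), ofReal_log hM]
        rfl
      rw [this, ofReal_re]
    have hmono : StrictMonoOn (fun x : ℝ => (H x).re) (Set.Icc 0 1) := by
      refine strictMonoOn_of_deriv_pos (convex_Icc 0 1)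
        (fun x hx => (hd x hx).continuousAt.continuousWithinAt) fun x hx => ?_
      rw [interior_Icc] at hx
      rw [(hd x ⟨hx.1.le, hx.2.le⟩).deriv]
      have hx3 : x ^ 3 ≤ 1 := pow_le_one₀ hx.1.le hx.2.le
      have hx3' : 0 ≤ x ^ 3 := pow_nonneg hx.1.le 3
      have hM : (0 : ℝ) < 3 - σ + σ * x ^ 3 := by
        rcases hσ with rfl | rfl <;> linarith
      have := hx.1
      positivity
    have := hmono (Set.left_mem_Icc.2 zero_le_one) (Set.right_mem_Icc.2 zero_le_one) zero_lt_one
    simpa [H0] using this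

/-- The point `exp (2 π i τ)` on the unit circle. -/
def turn (τ : ℝ) : ℂ := exp (2 * Real.pi * I * τ)

theorem norm_turn (τ : ℝ) : ‖turn τ‖ = 1 := by
  rw [turn, show (2 * Real.pi * I * τ : ℂ) = ((2 * Real.pi * τ : ℝ) : ℂ) * I by push_cast; ring,
    norm_exp_ofReal_mul_I]

theorem hasDerivAt_const_mul_ofReal (k : ℂ) (τ : ℝ) :
    HasDerivAt (fun τ : ℝ => k * (τ : ℂ)) k τ := by
  simpa using (ofRealCLM.hasDerivAt (x := τ)).const_mul k

theorem hasDerivAt_turn (τ : ℝ) : HasDerivAt turn (2 * Real.pi * I * turn τ) τ := by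
  rw [mul_comm]
  exact (hasDerivAt_const_mul_ofReal _ τ).cexp

theorem turn_zero : turn 0 = 1 := by simp [turn]

theorem turn_one : turn 1 = 1 := by simp [turn, exp_two_pi_mul_I]

/-- The first point moves on the unit circle around the fourth point `1` (for `σ = 1`) or around
the third point `-1` (for `σ = -1`), starting from the origin. -/
def loopCurve (σ τ : ℝ) : Fin 4 → ℂ := ![σ * (1 - turn τ), 3, -1, 1]

theorem crossX_loopCurve (σ τ : ℝ) : crossX (loopCurve σ τ) = 2 * loopM σ (turn τ) := by
  simp [crossX, loopCurve, loopM]; ring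

theorem crossY_loopCurve (σ τ : ℝ) : crossY (loopCurve σ τ) = 2 * (1 + σ * (1 - turn τ)) := by
  simp [crossY, loopCurve]; ring

theorem crossT_loopCurve (σ τ : ℝ) : crossT (loopCurve σ τ) = -4 * (1 - σ * (1 - turn τ)) := by
  simp [crossT, loopCurve]; ring

theorem turn_ne_zero (τ : ℝ) : turn τ ≠ 0 := exp_ne_zero _

theorem two_sub_turn_ne_zero (τ : ℝ) : 2 - turn τ ≠ 0 :=
  slitPlane_ne_zero (two_sub_mem_slitPlane (by rw [norm_turn]; norm_num))

theorem loopM_turn_ne_zero {σ : ℝ} (hσ : σ = 1 ∨ σ = -1) (τ : ℝ) : loopM σ (turn τ) ≠ 0 :=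
  slitPlane_ne_zero (loopM_mem_slitPlane hσ (by rw [norm_turn]; norm_num))

theorem injective_loopCurve {σ : ℝ} (hσ : σ = 1 ∨ σ = -1) (τ : ℝ) :
    Function.Injective (loopCurve σ τ) := by
  rw [injective_iff_cross, crossX_loopCurve, crossY_loopCurve, crossT_loopCurve]
  have h0 := turn_ne_zero τ
  have h1 := two_sub_turn_ne_zero τ
  refine ⟨mul_ne_zero two_ne_zero (loopM_turn_ne_zero hσ τ), mul_ne_zero two_ne_zero ?_,
    mul_ne_zero (by norm_num) ?_⟩
  · rcases hσ with rfl | rfl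
    · convert h1 using 1; push_cast; ring
    · convert h0 using 1; push_cast; ring
  · rcases hσ with rfl | rfl
    · convert h0 using 1; push_cast; ring
    · convert h1 using 1; push_cast; ring

theorem hasDerivAt_loopCurve (σ τ : ℝ) :
    HasDerivAt (loopCurve σ) ![-(σ * (2 * Real.pi * I * turn τ)), 0, 0, 0] τ := by
  rw [hasDerivAt_pi]
  intro i
  fin_cases i
  · simpa [loopCurve] using! ((hasDerivAt_turn τ).const_sub 1).const_mul (σ : ℂ)
  all_goals exact hasDerivAt_const _ _

/-- The configuration `(0, 3, -1, 1)`. Its points are real, and the first one lies on the segment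
between the last two, so that the integrals from either of them are real. -/
def basePoint : Conf 4 :=
  ⟨![0, 3, -1, 1], by simpa [loopCurve, turn_zero] using injective_loopCurve (Or.inl rfl) 0⟩

/-- The loop of configurations `loopCurve`. -/
def loop {σ : ℝ} (hσ : σ = 1 ∨ σ = -1) : Path basePoint basePoint where
  toFun t := ⟨loopCurve σ t, injective_loopCurve hσ t⟩
  continuous_toFun := by
    refine Continuous.subtype_mk ?_ _
    have : Continuous (loopCurve σ) :=
      continuous_iff_continuousAt.2 fun τ => (hasDerivAt_loopCurve σ τ).continuousAt
    exact this.comp continuous_subtype_val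
  source' := Subtype.ext (by simp [loopCurve, turn_zero, basePoint])
  target' := Subtype.ext (by simp [loopCurve, turn_one, basePoint])

theorem logDeriv_crossX_loopCurve {σ : ℝ} (hσ : σ = 1 ∨ σ = -1) (τ : ℝ) :
    crossX' (loopCurve σ τ) ![-(σ * (2 * Real.pi * I * turn τ)), 0, 0, 0] /
      crossX (loopCurve σ τ) = σ * (2 * Real.pi * I * turn τ) / loopM σ (turn τ) := by
  have := loopM_turn_ne_zero hσ τ
  rw [crossX_loopCurve]
  simp [crossX', loopCurve]
  field_simp
  ring

theorem logDeriv_crossY_add_crossT_loopCurve {σ : ℝ} (hσ : σ = 1 ∨ σ = -1) (τ : ℝ) :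
    crossY' (loopCurve σ τ) ![-(σ * (2 * Real.pi * I * turn τ)), 0, 0, 0] /
      crossY (loopCurve σ τ) +
    crossT' (loopCurve σ τ) ![-(σ * (2 * Real.pi * I * turn τ)), 0, 0, 0] /
      crossT (loopCurve σ τ) = 2 * Real.pi * I * (1 - turn τ / (2 - turn τ)) := by
  have h0 := turn_ne_zero τ
  have h1 := two_sub_turn_ne_zero τ
  rw [crossY_loopCurve, crossT_loopCurve]
  simp [crossY', crossT', loopCurve]
  rcases hσ with rfl | rfl
  · rw [show (1 + (1 : ℝ) * (1 - turn τ) : ℂ) = 2 - turn τ by push_cast; ring,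
      show (1 - (1 : ℝ) * (1 - turn τ) : ℂ) = turn τ by push_cast; ring]
    push_cast
    field_simp
    ring
  · rw [show (1 + (-1 : ℝ) * (1 - turn τ) : ℂ) = turn τ by push_cast; ring,
      show (1 - (-1 : ℝ) * (1 - turn τ) : ℂ) = 2 - turn τ by push_cast; ring]
    push_cast
    field_simp
    ring

theorem logDeriv_crossY_sub_crossT_loopCurve {σ : ℝ} (hσ : σ = 1 ∨ σ = -1) (τ : ℝ) :
    crossY' (loopCurve σ τ) ![-(σ * (2 * Real.pi * I * turn τ)), 0, 0, 0] /
      crossY (loopCurve σ τ) -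
    crossT' (loopCurve σ τ) ![-(σ * (2 * Real.pi * I * turn τ)), 0, 0, 0] /
      crossT (loopCurve σ τ) = -σ * (2 * Real.pi * I) * (2 / (2 - turn τ)) := by
  have h0 := turn_ne_zero τ
  have h1 := two_sub_turn_ne_zero τ
  rw [crossY_loopCurve, crossT_loopCurve]
  simp [crossY', crossT', loopCurve]
  rcases hσ with rfl | rfl
  · rw [show (1 + (1 : ℝ) * (1 - turn τ) : ℂ) = 2 - turn τ by push_cast; ring,
      show (1 - (1 : ℝ) * (1 - turn τ) : ℂ) = turn τ by push_cast; ring]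
    push_cast
    field_simp
    ring
  · rw [show (1 + (-1 : ℝ) * (1 - turn τ) : ℂ) = turn τ by push_cast; ring,
      show (1 - (-1 : ℝ) * (1 - turn τ) : ℂ) = 2 - turn τ by push_cast; ring]
    push_cast
    field_simp
    ring

/-- The continuous branch of a multiple of `(XYT)^{-1/6}` along `loopCurve`. -/
def loopRoot (σ τ : ℝ) : ℂ :=
  exp (-(1 / 6) * (2 * Real.pi * I * τ + (log (2 - turn τ) + log (loopM σ (turn τ)))))

theorem hasDerivAt_loopRoot {σ : ℝ} (hσ : σ = 1 ∨ σ = -1) (τ : ℝ) :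
    HasDerivAt (loopRoot σ) (loopRoot σ τ * (-(1 / 6) * (2 * Real.pi * I +
      (-(2 * Real.pi * I * turn τ) / (2 - turn τ) +
        σ * (2 * Real.pi * I * turn τ) / loopM σ (turn τ))))) τ := by
  have hE : ‖turn τ‖ < 2 := by rw [norm_turn]; norm_num
  have h1 := ((hasDerivAt_turn τ).const_sub 2).clog_real (two_sub_mem_slitPlane hE)
  have h2 : HasDerivAt (fun τ => loopM σ (turn τ)) (σ * (2 * Real.pi * I * turn τ)) τ :=
    ((hasDerivAt_turn τ).const_mul (σ : ℂ)).const_add (3 - σ : ℂ)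
  exact (((hasDerivAt_const_mul_ofReal _ τ).add
    (h1.add (h2.clog_real (loopM_mem_slitPlane hσ hE)))).const_mul (-(1 / 6) : ℂ)).cexp

theorem loopRoot_one (σ : ℝ) : loopRoot σ 1 = exp (-(Real.pi * I / 3)) * loopRoot σ 0 := by
  rw [loopRoot, loopRoot, ← exp_add, turn_zero, turn_one]
  congr 1
  push_cast
  ring

/-- A solution which is multiplied by a constant along the loop gives an eigenvector of the
monodromy. -/
theorem transport_loop_eq_smul {σ : ℝ} (hσ : σ = 1 ∨ σ = -1) {F β : ℝ → ℂ}
    (hF : ∀ τ, HasDerivAt F (β τ / (6 * loopM σ (turn τ)) *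
      (-σ * (2 * Real.pi * I) * (2 / (2 - turn τ)))) τ)
    (hβ : ∀ τ, HasDerivAt β (β τ * (2 / 3 * (2 * Real.pi * I * (1 - turn τ / (2 - turn τ))) -
      1 / 3 * (σ * (2 * Real.pi * I * turn τ) / loopM σ (turn τ)))) τ)
    {m : ℂ} (hF1 : F 1 = m * F 0) (hβ1 : β 1 = m * β 0) :
    transport (.mk (loop hσ)) (coord.symm (F 0 * 2 + β 0, F 0 * 6)) =
      (exp (-(Real.pi * I / 3)) * m) • coord.symm (F 0 * 2 + β 0, F 0 * 6) := by
  have hflat := isFlatAlong_of_curve (γ := loop hσ) (hasDerivAt_loopCurve σ) (fun t => rfl)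
    (w := fun τ => (loopRoot σ τ * (F τ * crossY (loopCurve σ τ) + β τ),
      loopRoot σ τ * (F τ * crossX (loopCurve σ τ)))) fun τ => by
    refine flatPair_of_hasDerivAt (hasDerivAt_loopCurve σ τ) (injective_loopCurve hσ τ)
      ((hasDerivAt_loopRoot hσ τ).congr_deriv ?_) ?_ ?_
    · rw [logDeriv_crossX_loopCurve hσ, logDeriv_crossY_add_crossT_loopCurve hσ]
      ring
    · rw [logDeriv_crossY_sub_crossT_loopCurve hσ, crossX_loopCurve]
      refine (hF τ).congr_deriv ?_
      ring
    · rw [logDeriv_crossX_loopCurve hσ, logDeriv_crossY_add_crossT_loopCurve hσ]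
      exact hβ τ
  have hX : ∀ τ, turn τ = 1 → crossX (loopCurve σ τ) = 6 := fun τ h => by
    rw [crossX_loopCurve, h, loopM]; ring
  have hY : ∀ τ, turn τ = 1 → crossY (loopCurve σ τ) = 2 := fun τ h => by
    rw [crossY_loopCurve, h]; ring
  have h := (transport_mk_eq_iff (loop hσ) _ _).2 ⟨_, hflat, rfl, rfl⟩
  simp only [Set.Icc.coe_zero, Set.Icc.coe_one, hX 0 turn_zero, hX 1 turn_one, hY 0 turn_zero,
    hY 1 turn_one, loopRoot_one, hF1, hβ1] at h
  have g0 : loopRoot σ 0 ≠ 0 := exp_ne_zero _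
  have e1 : ((loopRoot σ 0 * (F 0 * 2 + β 0), loopRoot σ 0 * (F 0 * 6)) : ℂ × ℂ) =
      loopRoot σ 0 • (F 0 * 2 + β 0, F 0 * 6) := rfl
  have e2 : ((exp (-(Real.pi * I / 3)) * loopRoot σ 0 * (m * F 0 * 2 + m * β 0),
      exp (-(Real.pi * I / 3)) * loopRoot σ 0 * (m * F 0 * 6)) : ℂ × ℂ) =
      loopRoot σ 0 • (exp (-(Real.pi * I / 3)) * m) • (F 0 * 2 + β 0, F 0 * 6) := by
    ext <;> simp <;> ring
  rw [e1, e2] at h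
  simp only [map_smul] at h
  exact smul_right_injective _ g0 h

/-- An eigenvector of the monodromy along one of the two loops which is not on the invariant line
is determined up to a factor by the value `H 1` of the primitive. -/
theorem eigenvector_loop {σ : ℝ} (hσ : σ = 1 ∨ σ = -1) : ∃ h : ℂ, 0 < h.re ∧
    ∀ (a : Coinvariants 4) (k : ℂ), transport (.mk (loop hσ)) a = k • a →
      a ∉ invariantLine basePoint.1 →
      (coord a).2 * (-3 * σ * loopN 1 1) = h * ((coord a).1 * 6 - (coord a).2 * 2) := by
  obtain ⟨H, hH, hrot, hpos⟩ := exists_loop_primitive hσ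
  refine ⟨H 1, hpos, fun a k hk ha => ?_⟩
  have hσ2 : (σ : ℂ) * σ = 1 := by rcases hσ with rfl | rfl <;> simp
  -- the cube root `s` of `turn` along the loop
  set s : ℝ → ℂ := fun τ => exp (2 * Real.pi * I / 3 * τ) with hs
  have hs3 : ∀ τ, s τ ^ 3 = turn τ := fun τ => by
    rw [hs, turn, ← exp_nat_mul]
    congr 1
    push_cast
    ring
  have hs1 : ∀ τ, ‖s τ‖ = 1 := fun τ => by
    have : ‖s τ‖ ^ 3 = 1 := by rw [← norm_pow, hs3, norm_turn]
    exact (pow_eq_one_iff_of_nonneg (norm_nonneg _) three_ne_zero).1 this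
  have ds : ∀ τ, HasDerivAt s (s τ * (2 * Real.pi * I / 3)) τ := fun τ =>
    (hasDerivAt_const_mul_ofReal _ τ).cexp
  have s0 : s 0 = 1 := by simp [hs]
  have hω : s 1 ^ 3 = 1 := by rw [hs3, turn_one]
  have hω2 : s 1 ^ 2 ≠ 1 := by
    intro h
    have h1 : s 1 = 1 := by linear_combination hω - s 1 * h
    have h2 : exp (2 * Real.pi * I / 3 * (1 : ℝ)) = 1 := h1
    obtain ⟨n, hn⟩ := exp_eq_one_iff.1 h2
    have h3 : (2 * Real.pi * I) * (1 - 3 * n) = 0 := by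
      push_cast at hn
      linear_combination 3 * hn
    have h4 : (1 - 3 * n : ℂ) = 0 := (mul_eq_zero.1 h3).resolve_left two_pi_I_ne_zero
    have h5 : (1 - 3 * n : ℤ) = 0 := by exact_mod_cast h4
    omega
  have hE : ∀ τ, ‖turn τ‖ < 2 := fun τ => by rw [norm_turn]; norm_num
  have hN1 : loopN σ 1 = loopN 1 1 := by simp [loopN, loopM]
  have hN0 : loopN 1 1 ≠ 0 := exp_ne_zero _
  let β : ℝ → ℂ := fun τ => -3 * σ * (s τ ^ 2 * ((2 - turn τ) * loopN σ (turn τ)))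
  have hβ0 : β 0 = -3 * σ * loopN 1 1 := by
    simp only [β, s0, turn_zero, hN1]; ring
  have h1 := transport_loop_eq_smul hσ (F := H ∘ s) (β := β) (m := s 1 ^ 2)
    (fun τ => by
      refine ((hH (s τ) (hs1 τ)).comp τ (ds τ)).congr_deriv ?_
      have := two_sub_turn_ne_zero τ
      have := loopM_turn_ne_zero hσ τ
      rw [hs3]
      simp only [β]
      field_simp
      linear_combination (-6 * s τ ^ 2 * loopN σ (turn τ)) * hσ2)
    (fun τ => by
      have dN := (hasDerivAt_loopN hσ (hE τ)).comp τ (hasDerivAt_turn τ)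
      have d := (((ds τ).pow 2).mul (((hasDerivAt_turn τ).const_sub 2).mul dN)).const_mul
        (-3 * σ : ℂ)
      refine d.congr_deriv ?_
      have := two_sub_turn_ne_zero τ
      have := loopM_turn_ne_zero hσ τ
      simp [β]
      field_simp
      ring)
    (by simp only [Function.comp_apply, s0]; exact hrot _ hω)
    (by simp only [β, s0, turn_zero, turn_one]; ring)
  have h2 := transport_loop_eq_smul hσ (F := fun _ => 1) (β := fun _ => 0) (m := 1)
    (fun τ => by simpa using! hasDerivAt_const τ (1 : ℂ))
    (fun τ => by simpa using! hasDerivAt_const τ (0 : ℂ)) (by simp) (by simp)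
  simp only [Function.comp_apply, s0, hβ0] at h1
  have hν : exp (-(Real.pi * I / 3)) ≠ 0 := exp_ne_zero _
  generalize hb : loopN 1 1 = b at *
  generalize exp (-(Real.pi * I / 3)) = ν at *
  set v : ℂ × ℂ := (H 1 * 2 + -3 * σ * b, H 1 * 6) with hv
  set w : ℂ × ℂ := (1 * 2 + 0, 1 * 6) with hw
  -- expand `a` in the basis of eigenvectors `w`, `v`
  have hσ0 : (σ : ℂ) ≠ 0 := left_ne_zero_of_mul_eq_one hσ2
  have hind : w.1 * v.2 - w.2 * v.1 ≠ 0 := by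
    rw [hv, hw]
    have : (1 * 2 + 0) * (H 1 * 6) - 1 * 6 * (H 1 * 2 + -3 * σ * b) = 18 * (σ * b) := by ring
    simp only [this]
    exact mul_ne_zero (by norm_num) (mul_ne_zero hσ0 hN0)
  obtain ⟨c, hc⟩ : ∃ c : ℂ × ℂ, coord a = c.1 • w + c.2 • v :=
    ⟨_, (cramer_combination hind (w := coord a)).symm⟩
  have hac : a = c.1 • coord.symm w + c.2 • coord.symm v := by
    rw [← map_smul, ← map_smul, ← map_add, ← hc, LinearEquiv.symm_apply_apply]
  have hlin : ∀ d : ℂ × ℂ, d.1 • coord.symm w + d.2 • coord.symm v = 0 → d = 0 := by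
    intro d hd
    rw [← map_smul, ← map_smul, ← map_add, LinearEquiv.map_eq_zero_iff] at hd
    rw [← cramer_of_combination hind d, hd]
    simp [cramer]
  have hzero := hlin (c.1 * (ν * 1 - k), c.2 * (ν * s 1 ^ 2 - k)) <| by
    rw [hac, map_add, map_smul, map_smul, h1, h2] at hk
    rw [← sub_eq_zero] at hk
    rw [← hk]
    module
  have hc2 : c.2 ≠ 0 := by
    intro h0
    apply ha
    rw [mem_invariantLine, hc, h0]
    simp [hw, basePoint, crossX, crossY]
    ring
  have hk' : ν * s 1 ^ 2 = k :=
    sub_eq_zero.1 ((mul_eq_zero.1 (congrArg Prod.snd hzero)).resolve_left hc2)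
  have hc1 : c.1 = 0 := by
    refine (mul_eq_zero.1 (congrArg Prod.fst hzero)).resolve_right fun h => ?_
    rw [← hk'] at h
    have : ν * (1 - s 1 ^ 2) = 0 := by linear_combination h
    exact hω2 (sub_eq_zero.1 ((mul_eq_zero.1 this).resolve_left hν)).symm
  rw [hc, hc1]
  simp [hv]
  ring

/-! ### The monodromy representation is not semisimple -/

/-- Two configurations lie on a complex line, which meets the complement of the configuration space
in finitely many points. -/
theorem nonempty_path (x y : Conf 4) : Nonempty (Path x y) := by
  let c : ℂ → Fin 4 → ℂ := fun s i => x.1 i + s * (y.1 i - x.1 i)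
  have hc : Continuous c := by fun_prop
  let B : Set ℂ := {s | ¬ Function.Injective (c s)}
  have hB : B.Countable := by
    refine (Set.countable_iUnion fun p : Fin 4 × Fin 4 =>
      (Set.Subsingleton.countable (s := {s | p.1 ≠ p.2 ∧ c s p.1 = c s p.2}) ?_)).mono ?_
    · rintro s ⟨hp, hs⟩ t ⟨-, ht⟩
      have hx : x.1 p.1 - x.1 p.2 ≠ 0 := sub_ne_zero.2 (x.2.ne hp)
      simp only [c] at hs ht
      have h1 : (s - t) * (x.1 p.1 - x.1 p.2) = 0 := by
        linear_combination s * ht - t * hs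
      exact sub_eq_zero.1 ((mul_eq_zero.1 h1).resolve_right hx)
    · intro s hs
      simp only [B, Function.Injective, not_forall, Set.mem_ofPred_eq] at hs
      obtain ⟨i, j, h, hij⟩ := hs
      exact Set.mem_iUnion.2 ⟨(i, j), hij, h⟩
  have hpc := hB.isPathConnected_compl_of_one_lt_rank
    (by rw [Complex.rank_real_complex]; norm_num)
  have h0 : c 0 = x.1 := by ext; simp [c]
  have h1 : c 1 = y.1 := by ext; simp [c]
  obtain ⟨p, hp⟩ := hpc.joinedIn 0 (by simpa [B, h0] using x.2) 1 (by simpa [B, h1] using y.2)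
  exact ⟨⟨⟨fun t => ⟨c (p t), not_not.1 (hp t)⟩, by fun_prop⟩,
    Subtype.ext (by simp [h0]), Subtype.ext (by simp [h1])⟩⟩

theorem transport_symm_transport {x y : Conf 4} (δ : Path x y) (a : Coinvariants 4) :
    transport (.mk δ.symm) (transport (.mk δ) a) = a := by
  have h := transport_trans (.mk δ) (.mk δ.symm)
  rw [← Path.Homotopic.Quotient.mk_trans,
    Path.Homotopic.Quotient.eq.2 ⟨(Path.Homotopy.reflTransSymm δ).symm⟩] at h
  exact (LinearMap.congr_fun h a).symm.trans (LinearMap.congr_fun (transport_refl x) a)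

theorem exists_mem_invariantLine (z : Conf 4) : ∃ w ∈ invariantLine z.1, w ≠ 0 := by
  refine ⟨coord.symm (crossY z.1, crossX z.1), ?_, ?_⟩
  · rw [mem_invariantLine, LinearEquiv.apply_symm_apply]
    ring
  · rw [ne_eq, LinearEquiv.map_eq_zero_iff]
    exact fun h => ((injective_iff_cross z.1).1 z.2).1 (congrArg Prod.snd h)

theorem invariantLine_ne_top (z : Conf 4) : invariantLine z.1 ≠ ⊤ := by
  intro h
  have : coord.symm (1, 0) ∈ invariantLine z.1 := h ▸ Submodule.mem_top
  rw [mem_invariantLine, LinearEquiv.apply_symm_apply] at this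
  simp only [one_mul, zero_mul] at this
  exact ((injective_iff_cross z.1).1 z.2).1 this

/-- A proper subspace of the two-dimensional space of coinvariants is spanned by any of its non-zero
vectors. -/
theorem exists_smul_of_mem {L : Submodule ℂ (Coinvariants 4)} (hL : L ≠ ⊤) {a b : Coinvariants 4}
    (ha : a ∈ L) (ha0 : a ≠ 0) (hb : b ∈ L) : ∃ k : ℂ, b = k • a := by
  by_contra hk
  push Not at hk
  apply hL
  have hli : LinearIndependent ℂ ![a, b] := by
    rw [LinearIndependent.pair_iff' ha0]
    exact fun k h => hk k h.symm
  have hspan := hli.span_eq_top_of_card_eq_finrank (by simp [finrank_coinvariants])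
  rw [eq_top_iff, ← hspan, Submodule.span_le]
  rintro _ ⟨i, rfl⟩
  fin_cases i
  · exact ha
  · exact hb

theorem not_isSemisimple_monodromyRep (z₀ : Conf 4) :
    ¬ (monodromyRep z₀).IsSemisimpleRepresentation := by
  intro hss
  let L₁ : Subrepresentation (monodromyRep z₀) :=
    { toSubmodule := invariantLine z₀.1
      apply_mem_toSubmodule := fun γ v hv => by
        obtain ⟨γ⟩ := γ
        exact transport_mem_invariantLine γ hv }
  obtain ⟨L₂, hL⟩ := hss.exists_isCompl L₁
  have hinf : invariantLine z₀.1 ⊓ L₂.toSubmodule = ⊥ := by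
    have := congrArg Subrepresentation.toSubmodule hL.inf_eq_bot
    rwa [Subrepresentation.toSubmodule_inf] at this
  have hsup : invariantLine z₀.1 ⊔ L₂.toSubmodule = ⊤ := by
    have := congrArg Subrepresentation.toSubmodule hL.sup_eq_top
    rwa [Subrepresentation.toSubmodule_sup] at this
  have hL₂ : L₂.toSubmodule ≠ ⊤ := by
    intro h
    obtain ⟨w, hw, hw0⟩ := exists_mem_invariantLine z₀
    rw [h, inf_top_eq] at hinf
    rw [hinf] at hw
    exact hw0 hw
  have hL₂' : L₂.toSubmodule ≠ ⊥ := by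
    intro h
    rw [h, sup_bot_eq] at hsup
    exact invariantLine_ne_top z₀ hsup
  obtain ⟨a, ha, ha0⟩ := Submodule.exists_mem_ne_zero_of_ne_bot hL₂'
  have haL : a ∉ invariantLine z₀.1 := fun h => by
    have : a ∈ invariantLine z₀.1 ⊓ L₂.toSubmodule := ⟨h, ha⟩
    rw [hinf] at this
    exact ha0 this
  -- transport the complement to the base point of the two loops
  obtain ⟨δ⟩ := nonempty_path z₀ basePoint
  set a' := transport (.mk δ) a with ha'
  have haL' : a' ∉ invariantLine basePoint.1 := fun h => by
    have := transport_mem_invariantLine δ.symm h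
    rw [ha', transport_symm_transport] at this
    exact haL this
  have heigen : ∀ ℓ : Path basePoint basePoint, ∃ k : ℂ, transport (.mk ℓ) a' = k • a' := by
    intro ℓ
    have hmem := L₂.apply_mem_toSubmodule
      (FundamentalGroup.fromPath (.mk ((δ.trans ℓ).trans δ.symm))) ha
    obtain ⟨k, hk⟩ := exists_smul_of_mem hL₂ ha ha0 hmem
    refine ⟨k, ?_⟩
    have h1 : transport (.mk ((δ.trans ℓ).trans δ.symm)) a = k • a := hk
    rw [Path.Homotopic.Quotient.mk_trans, Path.Homotopic.Quotient.mk_trans, transport_trans,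
      transport_trans, Module.End.mul_apply, Module.End.mul_apply] at h1
    have h2 := congrArg (transport (.mk δ)) h1
    have h3 := transport_symm_transport δ.symm (transport (.mk ℓ) a')
    rw [Path.symm_symm] at h3
    rw [h3, map_smul] at h2
    exact h2
  obtain ⟨h₁, hpos₁, H₁⟩ := eigenvector_loop (σ := 1) (Or.inl rfl)
  obtain ⟨h₂, hpos₂, H₂⟩ := eigenvector_loop (σ := -1) (Or.inr rfl)
  obtain ⟨k₁, hk₁⟩ := heigen (loop (Or.inl rfl))
  obtain ⟨k₂, hk₂⟩ := heigen (loop (Or.inr rfl))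
  have e₁ := H₁ a' k₁ hk₁ haL'
  have e₂ := H₂ a' k₂ hk₂ haL'
  have hd : (coord a').1 * 6 - (coord a').2 * 2 ≠ 0 := by
    intro h
    apply haL'
    rw [mem_invariantLine]
    simp [basePoint, crossX, crossY]
    linear_combination h
  have hsum : (h₁ + h₂) * ((coord a').1 * 6 - (coord a').2 * 2) = 0 := by
    push_cast at e₁ e₂
    linear_combination -e₁ - e₂
  have h0 := (mul_eq_zero.1 hsum).resolve_right hd
  have : (h₁ + h₂).re = 0 := by rw [h0]; rfl
  rw [Complex.add_re] at this
  linarith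

end KZ
end

theorem mainTheorem8 :
    Module.finrank ℂ (KZ.Coinvariants 4) = 2 ∧
      ∀ z₀ : KZ.Conf 4,
        (∃! ρ : Representation ℂ (FundamentalGroup (KZ.Conf 4) z₀) (KZ.Coinvariants 4),
          KZ.IsMonodromy 3 z₀ ρ) ∧
        ∀ ρ : Representation ℂ (FundamentalGroup (KZ.Conf 4) z₀) (KZ.Coinvariants 4),
          KZ.IsMonodromy 3 z₀ ρ → ¬ ρ.IsSemisimpleRepresentation := by
  refine ⟨KZ.finrank_coinvariants, fun z₀ => ⟨⟨KZ.monodromyRep z₀, KZ.isMonodromy_monodromyRep z₀,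
    fun ρ hρ => hρ.eq_monodromyRep⟩, fun ρ hρ => ?_⟩⟩
  rw [hρ.eq_monodromyRep]
  exact KZ.not_isSemisimple_monodromyRep z₀
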